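/- **Noninterference.** A *machine* consists of states $S$, events $E$, input data $I$, a step relation $s\xrightarrow{\alpha}s'$ with actions $\alpha\in E\cup\{\tau\}$, and a map $\mathrm{init}:I\to S$. Write $s\xrightarrow{t}{}^{*}$ if some finite sequence of steps from $s$ produces the list $t$ of events (silent actions $\tau$ omitted). A *notion of observation* consists of a set $\Omega$ of observers and, for each $o\in\Omega$, a predicate "observable by $o$" on $E$ and a relation $\approx_o$ on $I$. The machine satisfies *termination-insensitive noninterference (TINI)* if for all $o\in\Omega$, all $i_1\approx_o i_2$ and all $t_1,t_2$ with $\mathrm{init}(i_1)\xrightarrow{t_1}{}^{*}$ and $\mathrm{init}(i_2)\xrightarrow{t_2}{}^{*}$, the sublists of the events of $t_1$ and of $t_2$ observable by $o$ are equal after truncating the longer one to the length of the shorter one. **Concrete machine.** Fix a default tag $T_D\in\mathbb Z$. Atoms $n@T$ are pairs of integers (payload, tag). A state $\langle\pi\ \kappa\ \mu\ [\sigma]\ pc\rangle$ consists of a privilege bit $\pi\in\{u,k\}$, kernel and user data memories $\kappa,\mu$ (partial functions from $\mathbb Z$ to atoms), a stack $\sigma$ of atoms and return frames $(pc',\pi')$,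 and an atom $pc$; there are a fixed user program $\iota$ and fixed kernel code $\phi$ (partial functions from $\mathbb N$ to instructions). The instructions are $\mathsf{Add},\mathsf{Sub},\mathsf{Output},\mathsf{Push}\,m,\mathsf{Load},\mathsf{Store},\mathsf{Jump},\mathsf{Bnz}\,k,\mathsf{Call},\mathsf{Ret}$, each with an integer opcode. Kernel cells $0,\dots,6$ are the rule cache, with payloads $(op,T_{pc},T_1,T_2,T_3\,\|\,T_{rpc},T_r)$; the first five are its input part. *User mode.* At $pc=n@T_{pc}$ the instruction $\iota(n)$ has the following effect (top of stack on the left); the cache input it needs is its opcode, $T_{pc}$ and the tags $T_1,T_2,T_3$ shown, with $T_D$ for those not shown. Unless stated otherwise the new $pc$ is $(n+1)@T_{rpc}$. $\mathsf{Add}$: $[n_1@T_1,n_2@T_2,\sigma]\to[(n_1+n_2)@T_r,\sigma]$; $\mathsf{Sub}$: the same with $n_1-n_2$; $\mathsf{Output}$: $[m@T_1,\sigma]\to[\sigma]$, emitting the event $m@T_r$; $\mathsf{Push}\,m$: $[\sigma]\to[m@T_r,\sigma]$; $\mathsf{Load}$, if $\mu(p)=m@T_2$: $[p@T_1,\sigma]\to[m@T_r,\sigma]$;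 $\mathsf{Store}$, if $\mu(p)=k@T_3$: $[p@T_1,m@T_2,\sigma]\to[\sigma]$ and $\mu(p):=m@T_r$; $\mathsf{Jump}$: $[n'@T_1,\sigma]\to[\sigma]$, $pc:=n'@T_{rpc}$; $\mathsf{Bnz}\,k$: $[m@T_1,\sigma]\to[\sigma]$, $pc:=(n+1)@T_{rpc}$ if $m=0$ and $(n+k)@T_{rpc}$ otherwise; $\mathsf{Call}$: $[n'@T_1,a,\sigma]\to[a,((n+1)@T_r,u),\sigma]$, $pc:=n'@T_{rpc}$; $\mathsf{Ret}$: $[(n'@T_1,u),\sigma]\to[\sigma]$, $pc:=n'@T_{rpc}$. If the cache input equals the needed one (hit), this step is made, with $T_{rpc},T_r$ from the cache; otherwise (miss) the needed input is written to the cache, the output part is set to $(T_D,T_D)$ (all written cells tagged $T_D$), the frame $(pc,u)$ is pushed, and the machine goes to kernel mode with $pc=0@T_D$. If the operands needed do not exist, there is no step. *Kernel mode.* Instructions come from $\phi$ and have the same effect on payloads, with $\kappa$ in place of $\mu$ and without using the cache; results and $pc$ get the tag $T_D$, except that $\mathsf{Load}$ and $\mathsf{Store}$ keep the tag of the atom they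 move, $\mathsf{Call}$ pushes $((n+1)@T_D,k)$, and $\mathsf{Ret}$ takes $pc$ (with its tag) and $\pi$ from the top frame. $\mathsf{Store}$ may write at any address; there is no $\mathsf{Output}$. Input data are $(p,args,n,T)$: the initial state runs program $p$ in user mode with $pc=0@T$, the list $args$ of atoms as stack, $\mu$ consisting of $n$ copies of $0@T$ at addresses $0,\dots,n-1$, and $\kappa$ consisting of the cache with an illegal opcode and all other payloads $T_D$. Events are atoms. **Rule table $\mathcal R^{\mathsf{abs}}$** (allowed if; label of the next pc; label of the result): add, sub, load: (true; $L_{pc}$; $L_1\sqcup L_2$); output: (true; $L_{pc}$; $L_1\sqcup L_{pc}$); push: (true; $L_{pc}$; $\bot$); store: ($L_1\sqcup L_{pc}\sqsubseteq L_3$; $L_{pc}$; $L_1\sqcup L_2\sqcup L_{pc}$); jump, bnz: (true; $L_1\sqcup L_{pc}$; $\bot$); call: (true; $L_1\sqcup L_{pc}$; $L_{pc}$); ret: (true; $L_1$; $\bot$). **Concrete lattice.** Let $\mathcal L$ be a partial order with binary joins $\vee$ and a least element $\bot$. A concrete lattice consists of $\mathsf{Tag}:\mathcal L\to\mathbb Z$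 and $\mathsf{Lab}:\mathbb Z\to\mathcal L$ with $\mathsf{Lab}\circ\mathsf{Tag}=\mathrm{id}$ and of instruction lists $\mathsf{genBot},\mathsf{genJoin},\mathsf{genFlows}$. It is *correct* if, placed anywhere in the kernel code and started in kernel mode at their first address with pc tag $T_D$, for any $\kappa,\mu,\sigma$ and any $L_1,L_2\in\mathcal L$, they run in kernel mode to the address just after them with pc tag $T_D$, leave $\kappa$ and $\mu$ unchanged, and change the stack as follows: $\mathsf{genBot}$: $[\sigma]\to[\mathsf{Tag}(\bot)@T_D,\sigma]$; $\mathsf{genJoin}$: $[\mathsf{Tag}(L_1)@T_D,\mathsf{Tag}(L_2)@T_D,\sigma]\to[\mathsf{Tag}(L_1\vee L_2)@T_D,\sigma]$; $\mathsf{genFlows}$: $[\mathsf{Tag}(L_1)@T_D,\mathsf{Tag}(L_2)@T_D,\sigma]\to[b@T_D,\sigma]$ with $b\neq0$ if and only if $L_1\le L_2$. **Fault handler $\phi_{\mathcal R^{\mathsf{abs}}}$.** This is the following code, stored from kernel address $0$ on. Write $\mathrm{if}(t,f)=[\mathsf{Bnz}(|f'|+1)]\,f'\,t$ with $f'=f\,[\mathsf{Push}\,1,\mathsf{Bnz}(|t|+1)]$,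 and $\mathrm{ld}(a)=[\mathsf{Push}\,a,\mathsf{Load}]$. A label expression is compiled by $\bot\mapsto\mathsf{genBot}$, $L_{pc},L_1,L_2,L_3\mapsto\mathrm{ld}(1),\dots,\mathrm{ld}(4)$, $e_1\sqcup e_2\mapsto[\![e_2]\!]\,[\![e_1]\!]\,\mathsf{genJoin}$; conditions by $\mathrm{true}\mapsto[\mathsf{Push}\,1]$, $e_1\sqsubseteq e_2\mapsto[\![e_2]\!]\,[\![e_1]\!]\,\mathsf{genFlows}$; a rule $(c;e;e')$ by $[\![c]\!]\ \mathrm{if}([\![e]\!]\,[\![e']\!]\,[\mathsf{Push}\,1],\,[\mathsf{Push}\,0])$. The handler is $D\ \ \mathrm{if}([\mathsf{Push}\,6,\mathsf{Store},\mathsf{Push}\,5,\mathsf{Store},\mathsf{Push}\,1],[\mathsf{Push}\,0])\ \ \mathrm{if}([\mathsf{Ret}],[\mathsf{Push}(-1),\mathsf{Jump}])$, where $D$ runs through the opcodes: $D$ is empty for the empty list, and for $op::ops$ it is $[\mathsf{Push}\,op]\ \mathrm{ld}(0)\ [\mathsf{Sub}]\ \mathrm{if}([\mathsf{Push}\,0],[\mathsf{Push}\,1])\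 \mathrm{if}(\text{rule of }op,\ D_{ops})$. **Observation.** The observers are the labels $o\in\mathcal L$; the event $n@T$ is observable by $o$ if $\mathsf{Lab}(T)\le o$; and $(p,args_1',n,\mathsf{Tag}(L))\approx_o(p,args_2',n,\mathsf{Tag}(L))$, for $L\in\mathcal L$, if $args_1',args_2'$ are obtained by applying $\mathsf{Tag}$ to the labels in two lists of the same length of labelled integers $n@L'$ ($L'\in\mathcal L$) which at each position are equal or both have labels $\not\le o$. (No other inputs are related.) **Theorem.** For every partial order $\mathcal L$ with binary joins and a least element, every $T_D\in\mathbb Z$ and every concrete lattice that is correct for $\mathcal L$, the concrete machine running the fault handler $\phi_{\mathcal R^{\mathsf{abs}}}$ satisfies TINI with respect to this notion of observation. -/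

import Mathlib

namespace IFC

/-! ## Generic machines, observations and noninterference -/

/-- A generic machine with states `S`, events `E` and input data `I`. An action is an `Option E`,
where `none` is the silent action `τ`. -/
structure Machine (S E I : Type*) where
  step : S → Option E → S → Prop
  start : I → S

/-- Reflexive-transitive closure of the step relation, collecting the events and omitting the
silent actions. -/
inductive Machine.Steps {S E I : Type*} (M : Machine S E I) : S → List E → S → Prop
  | refl (s : S) : Machine.Steps M s [] s
  | event {s₁ s₂ s₃ : S} {e : E} {t : List E} :
      M.step s₁ (some e) s₂ → Machine.Steps M s₂ t s₃ → Machine.Steps M s₁ (e :: t) s₃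
  | silent {s₁ s₂ s₃ : S} {t : List E} :
      M.step s₁ none s₂ → Machine.Steps M s₂ t s₃ → Machine.Steps M s₁ t s₃

/-- Some execution from `s` produces the trace `t`. -/
def Machine.Produces {S E I : Type*} (M : Machine S E I) (s : S) (t : List E) : Prop :=
  ∃ s', M.Steps s t s'

/-- A notion of observation with observers `Ω`: which events an observer sees, and which input
data an observer cannot distinguish. -/
structure Observation (E I Ω : Type*) where
  observable : Ω → E → Prop
  indist : Ω → I → I → Prop

open Classical in
/-- Remove the events that `o` does not observe from a trace. -/
noncomputable def Observation.filterTrace {E I Ω : Type*} (O : Observation E I Ω) (o : Ω)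
    (t : List E) : List E :=
  t.filter fun e => decide (O.observable o e)

/-- Indistinguishability of traces: equality after truncating the longer one. -/
inductive TraceIndist {E : Type*} : List E → List E → Prop
  | nil_left (t : List E) : TraceIndist [] t
  | nil_right (t : List E) : TraceIndist t []
  | cons (e : E) {t₁ t₂ : List E} : TraceIndist t₁ t₂ → TraceIndist (e :: t₁) (e :: t₂)

/-- Termination-insensitive noninterference. -/
def Machine.TINI {S E I Ω : Type*} (M : Machine S E I) (O : Observation E I Ω) : Prop :=
  ∀ (o : Ω) (i₁ i₂ : I) (t₁ t₂ : List E), O.indist o i₁ i₂ →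
    M.Produces (M.start i₁) t₁ → M.Produces (M.start i₂) t₂ →
    TraceIndist (O.filterTrace o t₁) (O.filterTrace o t₂)

/-! ## Instructions, opcodes, atoms -/

/-- The instruction set. `sub` is needed by the code generators below; it is an ordinary
instruction, handled exactly like `add`. -/
inductive Instr
  | add
  | sub
  | output
  | push (m : ℤ)
  | load
  | store
  | jump
  | bnz (k : ℤ)
  | call
  | ret

inductive Opcode
  | add
  | output
  | sub
  | push
  | load
  | store
  | jump
  | bnz
  | call
  | ret

/-- The integer that represents an opcode in the rule cache. -/
def Opcode.code : Opcode → ℤ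
  | .add => 0
  | .output => 1
  | .sub => 2
  | .push => 3
  | .load => 4
  | .store => 5
  | .jump => 6
  | .bnz => 7
  | .call => 8
  | .ret => 9

/-- An integer that represents no opcode. -/
def illegalOpcode : ℤ := -1

/-- The list of all opcodes. -/
def opcodes : List Opcode :=
  [.add, .output, .sub, .push, .load, .store, .jump, .bnz, .call, .ret]

/-- An integer payload with a label (`α` a label lattice) or with a concrete tag (`α = ℤ`). -/
structure Atom (α : Type*) where
  val : ℤ
  tag : α

abbrev CAtom := Atom ℤ

/-- Instruction memories: partial functions on non-negative addresses. -/
abbrev InstrMem := ℕ → Option Instr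

/-- The instruction at an integer address; there is none at a negative address. -/
def fetch (m : InstrMem) : ℤ → Option Instr
  | .ofNat n => m n
  | .negSucc _ => none

/-- Data memories: partial functions from integer addresses to atoms. -/
abbrev Mem := ℤ → Option CAtom

/-- The memory that agrees with `m` except at `p`, where its value is `a`. -/
def Mem.write (m : Mem) (p : ℤ) (a : CAtom) : Mem := Function.update m p (some a)

/-! ## The concrete machine -/

inductive Priv
  | user
  | kernel

/-- A stack element is an atom or a return frame, which holds a program counter and a privilege
bit. -/
inductive StackElt
  | data (a : CAtom)
  | frame (pc : CAtom) (π : Priv)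

abbrev Stack := List StackElt

structure CState where
  priv : Priv
  kmem : Mem
  mem : Mem
  stack : Stack
  pc : CAtom

/-! The rule cache occupies the first seven cells of kernel memory. -/

def addrOp : ℤ := 0
def addrTagPC : ℤ := 1
def addrTag1 : ℤ := 2
def addrTag2 : ℤ := 3
def addrTag3 : ℤ := 4
def addrTagRPC : ℤ := 5
def addrTagR : ℤ := 6

/-- The input part of a rule cache line. -/
structure CacheIn where
  op : ℤ
  tpc : ℤ
  t1 : ℤ
  t2 : ℤ
  t3 : ℤ

/-- The integer payload stored at address `p`. -/
def payload (κ : Mem) (p : ℤ) : Option ℤ := (κ p).map Atom.val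

/-- The input part of the cache in `κ` is `i`. -/
def CacheInputIs (κ : Mem) (i : CacheIn) : Prop :=
  payload κ addrOp = some i.op ∧ payload κ addrTagPC = some i.tpc ∧
    payload κ addrTag1 = some i.t1 ∧ payload κ addrTag2 = some i.t2 ∧
    payload κ addrTag3 = some i.t3

/-- The output part of the cache in `κ` consists of `trpc` and `tr`. -/
def CacheOutputIs (κ : Mem) (trpc tr : ℤ) : Prop :=
  payload κ addrTagRPC = some trpc ∧ payload κ addrTagR = some tr

/-- The cache in `κ` has input part `i` and output part `trpc`, `tr`. -/
def CacheHit (κ : Mem) (i : CacheIn) (trpc tr : ℤ) : Prop :=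
  CacheInputIs κ i ∧ CacheOutputIs κ trpc tr

/-- Set the input part of the cache to `i` and both cells of its output part to the default tag
`TD`; all cells written carry the tag `TD`. -/
def setCache (TD : ℤ) (κ : Mem) (i : CacheIn) : Mem :=
  ((((((κ.write addrOp ⟨i.op, TD⟩).write addrTagPC ⟨i.tpc, TD⟩).write addrTag1 ⟨i.t1, TD⟩).write
    addrTag2 ⟨i.t2, TD⟩).write addrTag3 ⟨i.t3, TD⟩).write addrTagRPC ⟨TD, TD⟩).write
      addrTagR ⟨TD, TD⟩

/-- The state reached by a cache miss: the cache input is loaded, the default tags are put in the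
cache output, and the fault handler at kernel address `0` is called. -/
def faultState (TD : ℤ) (κ μ : Mem) (σ : Stack) (pc : CAtom) (i : CacheIn) : CState :=
  ⟨.kernel, setCache TD κ i, μ, .frame pc .user :: σ, ⟨0, TD⟩⟩

open StackElt in
/-- The step relation of the concrete machine with default tag `TD`, user instruction memory `ι`
and kernel instruction memory `φ`. -/
inductive CStep (TD : ℤ) (ι φ : InstrMem) : CState → Option CAtom → CState → Prop
  -- user mode, cache hit
  | add {κ μ σ n tpc n₁ t₁ n₂ t₂ trpc tr} :
      fetch ι n = some .add → CacheHit κ ⟨Opcode.add.code, tpc, t₁, t₂, TD⟩ trpc tr →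
      CStep TD ι φ ⟨.user, κ, μ, data ⟨n₁, t₁⟩ :: data ⟨n₂, t₂⟩ :: σ, ⟨n, tpc⟩⟩ none
        ⟨.user, κ, μ, data ⟨n₁ + n₂, tr⟩ :: σ, ⟨n + 1, trpc⟩⟩
  | sub {κ μ σ n tpc n₁ t₁ n₂ t₂ trpc tr} :
      fetch ι n = some .sub → CacheHit κ ⟨Opcode.sub.code, tpc, t₁, t₂, TD⟩ trpc tr →
      CStep TD ι φ ⟨.user, κ, μ, data ⟨n₁, t₁⟩ :: data ⟨n₂, t₂⟩ :: σ, ⟨n, tpc⟩⟩ none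
        ⟨.user, κ, μ, data ⟨n₁ - n₂, tr⟩ :: σ, ⟨n + 1, trpc⟩⟩
  | output {κ μ σ n tpc m t₁ trpc tr} :
      fetch ι n = some .output → CacheHit κ ⟨Opcode.output.code, tpc, t₁, TD, TD⟩ trpc tr →
      CStep TD ι φ ⟨.user, κ, μ, data ⟨m, t₁⟩ :: σ, ⟨n, tpc⟩⟩ (some ⟨m, tr⟩)
        ⟨.user, κ, μ, σ, ⟨n + 1, trpc⟩⟩
  | push {κ μ σ n tpc m trpc tr} :
      fetch ι n = some (.push m) → CacheHit κ ⟨Opcode.push.code, tpc, TD, TD, TD⟩ trpc tr →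
      CStep TD ι φ ⟨.user, κ, μ, σ, ⟨n, tpc⟩⟩ none
        ⟨.user, κ, μ, data ⟨m, tr⟩ :: σ, ⟨n + 1, trpc⟩⟩
  | load {κ μ : Mem} {σ n tpc p t₁ m t₂ trpc tr} :
      fetch ι n = some .load → μ p = some ⟨m, t₂⟩ →
      CacheHit κ ⟨Opcode.load.code, tpc, t₁, t₂, TD⟩ trpc tr →
      CStep TD ι φ ⟨.user, κ, μ, data ⟨p, t₁⟩ :: σ, ⟨n, tpc⟩⟩ none
        ⟨.user, κ, μ, data ⟨m, tr⟩ :: σ, ⟨n + 1, trpc⟩⟩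
  | store {κ μ : Mem} {σ n tpc p t₁ m t₂ k t₃ trpc tr} :
      fetch ι n = some .store → μ p = some ⟨k, t₃⟩ →
      CacheHit κ ⟨Opcode.store.code, tpc, t₁, t₂, t₃⟩ trpc tr →
      CStep TD ι φ ⟨.user, κ, μ, data ⟨p, t₁⟩ :: data ⟨m, t₂⟩ :: σ, ⟨n, tpc⟩⟩ none
        ⟨.user, κ, μ.write p ⟨m, tr⟩, σ, ⟨n + 1, trpc⟩⟩
  | jump {κ μ σ n tpc n' t₁ trpc tr} :
      fetch ι n = some .jump → CacheHit κ ⟨Opcode.jump.code, tpc, t₁, TD, TD⟩ trpc tr →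
      CStep TD ι φ ⟨.user, κ, μ, data ⟨n', t₁⟩ :: σ, ⟨n, tpc⟩⟩ none
        ⟨.user, κ, μ, σ, ⟨n', trpc⟩⟩
  | bnz {κ μ σ n tpc k m t₁ trpc tr} :
      fetch ι n = some (.bnz k) → CacheHit κ ⟨Opcode.bnz.code, tpc, t₁, TD, TD⟩ trpc tr →
      CStep TD ι φ ⟨.user, κ, μ, data ⟨m, t₁⟩ :: σ, ⟨n, tpc⟩⟩ none
        ⟨.user, κ, μ, σ, ⟨n + (if m = 0 then 1 else k), trpc⟩⟩
  | call {κ μ σ n tpc n' t₁ a trpc tr} :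
      fetch ι n = some .call → CacheHit κ ⟨Opcode.call.code, tpc, t₁, TD, TD⟩ trpc tr →
      CStep TD ι φ ⟨.user, κ, μ, data ⟨n', t₁⟩ :: data a :: σ, ⟨n, tpc⟩⟩ none
        ⟨.user, κ, μ, data a :: frame ⟨n + 1, tr⟩ .user :: σ, ⟨n', trpc⟩⟩
  | ret {κ μ σ n tpc n' t₁ trpc tr} :
      fetch ι n = some .ret → CacheHit κ ⟨Opcode.ret.code, tpc, t₁, TD, TD⟩ trpc tr →
      CStep TD ι φ ⟨.user, κ, μ, frame ⟨n', t₁⟩ .user :: σ, ⟨n, tpc⟩⟩ none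
        ⟨.user, κ, μ, σ, ⟨n', trpc⟩⟩
  -- user mode, cache miss
  | addMiss {κ μ σ n tpc n₁ t₁ n₂ t₂} :
      fetch ι n = some .add → ¬ CacheInputIs κ ⟨Opcode.add.code, tpc, t₁, t₂, TD⟩ →
      CStep TD ι φ ⟨.user, κ, μ, data ⟨n₁, t₁⟩ :: data ⟨n₂, t₂⟩ :: σ, ⟨n, tpc⟩⟩ none
        (faultState TD κ μ (data ⟨n₁, t₁⟩ :: data ⟨n₂, t₂⟩ :: σ) ⟨n, tpc⟩
          ⟨Opcode.add.code, tpc, t₁, t₂, TD⟩)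
  | subMiss {κ μ σ n tpc n₁ t₁ n₂ t₂} :
      fetch ι n = some .sub → ¬ CacheInputIs κ ⟨Opcode.sub.code, tpc, t₁, t₂, TD⟩ →
      CStep TD ι φ ⟨.user, κ, μ, data ⟨n₁, t₁⟩ :: data ⟨n₂, t₂⟩ :: σ, ⟨n, tpc⟩⟩ none
        (faultState TD κ μ (data ⟨n₁, t₁⟩ :: data ⟨n₂, t₂⟩ :: σ) ⟨n, tpc⟩
          ⟨Opcode.sub.code, tpc, t₁, t₂, TD⟩)
  | outputMiss {κ μ σ n tpc m t₁} :
      fetch ι n = some .output → ¬ CacheInputIs κ ⟨Opcode.output.code, tpc, t₁, TD, TD⟩ →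
      CStep TD ι φ ⟨.user, κ, μ, data ⟨m, t₁⟩ :: σ, ⟨n, tpc⟩⟩ none
        (faultState TD κ μ (data ⟨m, t₁⟩ :: σ) ⟨n, tpc⟩
          ⟨Opcode.output.code, tpc, t₁, TD, TD⟩)
  | pushMiss {κ μ σ n tpc m} :
      fetch ι n = some (.push m) → ¬ CacheInputIs κ ⟨Opcode.push.code, tpc, TD, TD, TD⟩ →
      CStep TD ι φ ⟨.user, κ, μ, σ, ⟨n, tpc⟩⟩ none
        (faultState TD κ μ σ ⟨n, tpc⟩ ⟨Opcode.push.code, tpc, TD, TD, TD⟩)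
  | loadMiss {κ μ : Mem} {σ n tpc p t₁ m t₂} :
      fetch ι n = some .load → μ p = some ⟨m, t₂⟩ →
      ¬ CacheInputIs κ ⟨Opcode.load.code, tpc, t₁, t₂, TD⟩ →
      CStep TD ι φ ⟨.user, κ, μ, data ⟨p, t₁⟩ :: σ, ⟨n, tpc⟩⟩ none
        (faultState TD κ μ (data ⟨p, t₁⟩ :: σ) ⟨n, tpc⟩
          ⟨Opcode.load.code, tpc, t₁, t₂, TD⟩)
  | storeMiss {κ μ : Mem} {σ n tpc p t₁ m t₂ k t₃} :
      fetch ι n = some .store → μ p = some ⟨k, t₃⟩ →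
      ¬ CacheInputIs κ ⟨Opcode.store.code, tpc, t₁, t₂, t₃⟩ →
      CStep TD ι φ ⟨.user, κ, μ, data ⟨p, t₁⟩ :: data ⟨m, t₂⟩ :: σ, ⟨n, tpc⟩⟩ none
        (faultState TD κ μ (data ⟨p, t₁⟩ :: data ⟨m, t₂⟩ :: σ) ⟨n, tpc⟩
          ⟨Opcode.store.code, tpc, t₁, t₂, t₃⟩)
  | jumpMiss {κ μ σ n tpc n' t₁} :
      fetch ι n = some .jump → ¬ CacheInputIs κ ⟨Opcode.jump.code, tpc, t₁, TD, TD⟩ →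
      CStep TD ι φ ⟨.user, κ, μ, data ⟨n', t₁⟩ :: σ, ⟨n, tpc⟩⟩ none
        (faultState TD κ μ (data ⟨n', t₁⟩ :: σ) ⟨n, tpc⟩
          ⟨Opcode.jump.code, tpc, t₁, TD, TD⟩)
  | bnzMiss {κ μ σ n tpc k m t₁} :
      fetch ι n = some (.bnz k) → ¬ CacheInputIs κ ⟨Opcode.bnz.code, tpc, t₁, TD, TD⟩ →
      CStep TD ι φ ⟨.user, κ, μ, data ⟨m, t₁⟩ :: σ, ⟨n, tpc⟩⟩ none
        (faultState TD κ μ (data ⟨m, t₁⟩ :: σ) ⟨n, tpc⟩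
          ⟨Opcode.bnz.code, tpc, t₁, TD, TD⟩)
  | callMiss {κ μ σ n tpc n' t₁ a} :
      fetch ι n = some .call → ¬ CacheInputIs κ ⟨Opcode.call.code, tpc, t₁, TD, TD⟩ →
      CStep TD ι φ ⟨.user, κ, μ, data ⟨n', t₁⟩ :: data a :: σ, ⟨n, tpc⟩⟩ none
        (faultState TD κ μ (data ⟨n', t₁⟩ :: data a :: σ) ⟨n, tpc⟩
          ⟨Opcode.call.code, tpc, t₁, TD, TD⟩)
  | retMiss {κ μ σ n tpc n' t₁} :
      fetch ι n = some .ret → ¬ CacheInputIs κ ⟨Opcode.ret.code, tpc, t₁, TD, TD⟩ →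
      CStep TD ι φ ⟨.user, κ, μ, frame ⟨n', t₁⟩ .user :: σ, ⟨n, tpc⟩⟩ none
        (faultState TD κ μ (frame ⟨n', t₁⟩ .user :: σ) ⟨n, tpc⟩
          ⟨Opcode.ret.code, tpc, t₁, TD, TD⟩)
  -- kernel mode: tags are ignored, the cache is not consulted, there is no output
  | addK {κ μ σ n tpc n₁ t₁ n₂ t₂} :
      fetch φ n = some .add →
      CStep TD ι φ ⟨.kernel, κ, μ, data ⟨n₁, t₁⟩ :: data ⟨n₂, t₂⟩ :: σ, ⟨n, tpc⟩⟩ none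
        ⟨.kernel, κ, μ, data ⟨n₁ + n₂, TD⟩ :: σ, ⟨n + 1, TD⟩⟩
  | subK {κ μ σ n tpc n₁ t₁ n₂ t₂} :
      fetch φ n = some .sub →
      CStep TD ι φ ⟨.kernel, κ, μ, data ⟨n₁, t₁⟩ :: data ⟨n₂, t₂⟩ :: σ, ⟨n, tpc⟩⟩ none
        ⟨.kernel, κ, μ, data ⟨n₁ - n₂, TD⟩ :: σ, ⟨n + 1, TD⟩⟩
  | pushK {κ μ σ n tpc m} :
      fetch φ n = some (.push m) →
      CStep TD ι φ ⟨.kernel, κ, μ, σ, ⟨n, tpc⟩⟩ none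
        ⟨.kernel, κ, μ, data ⟨m, TD⟩ :: σ, ⟨n + 1, TD⟩⟩
  | loadK {κ μ : Mem} {σ n tpc p t₁ a} :
      fetch φ n = some .load → κ p = some a →
      CStep TD ι φ ⟨.kernel, κ, μ, data ⟨p, t₁⟩ :: σ, ⟨n, tpc⟩⟩ none
        ⟨.kernel, κ, μ, data a :: σ, ⟨n + 1, TD⟩⟩
  | storeK {κ μ : Mem} {σ n tpc p t₁ a} :
      fetch φ n = some .store →
      CStep TD ι φ ⟨.kernel, κ, μ, data ⟨p, t₁⟩ :: data a :: σ, ⟨n, tpc⟩⟩ none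
        ⟨.kernel, κ.write p a, μ, σ, ⟨n + 1, TD⟩⟩
  | jumpK {κ μ σ n tpc n' t₁} :
      fetch φ n = some .jump →
      CStep TD ι φ ⟨.kernel, κ, μ, data ⟨n', t₁⟩ :: σ, ⟨n, tpc⟩⟩ none
        ⟨.kernel, κ, μ, σ, ⟨n', TD⟩⟩
  | bnzK {κ μ σ n tpc k m t₁} :
      fetch φ n = some (.bnz k) →
      CStep TD ι φ ⟨.kernel, κ, μ, data ⟨m, t₁⟩ :: σ, ⟨n, tpc⟩⟩ none
        ⟨.kernel, κ, μ, σ, ⟨n + (if m = 0 then 1 else k), TD⟩⟩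
  | callK {κ μ σ n tpc n' t₁ a} :
      fetch φ n = some .call →
      CStep TD ι φ ⟨.kernel, κ, μ, data ⟨n', t₁⟩ :: data a :: σ, ⟨n, tpc⟩⟩ none
        ⟨.kernel, κ, μ, data a :: frame ⟨n + 1, TD⟩ .kernel :: σ, ⟨n', TD⟩⟩
  | retK {κ μ σ n tpc pc' π} :
      fetch φ n = some .ret →
      CStep TD ι φ ⟨.kernel, κ, μ, frame pc' π :: σ, ⟨n, tpc⟩⟩ none
        ⟨π, κ, μ, σ, pc'⟩

/-- Input data of the concrete machine: a program, the atoms on the initial stack, the size of the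
data memory, and the tag on the initial memory cells and the initial program counter. -/
structure CInput where
  prog : InstrMem
  args : List CAtom
  size : ℕ
  tag : ℤ

/-- The data memory that holds `n` copies of `0` with tag `T`, at the addresses `0, …, n - 1`. -/
def initMem (n : ℕ) (T : ℤ) : Mem := fun p => if 0 ≤ p ∧ p < n then some ⟨0, T⟩ else none

/-- The initial kernel memory: just the rule cache, with an illegal opcode. -/
def initKMem (TD : ℤ) : Mem := setCache TD (fun _ => none) ⟨illegalOpcode, TD, TD, TD, TD⟩

/-- The initial state: user mode, program counter `0`. -/
def initCState (TD : ℤ) (i : CInput) : CState :=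
  ⟨.user, initKMem TD, initMem i.size i.tag, i.args.map .data, ⟨0, i.tag⟩⟩

/-- The concrete machine, with default tag `TD` and kernel code `φ`, as a generic machine. Its
states carry the user program, which never changes. -/
def concreteMachine (TD : ℤ) (φ : InstrMem) : Machine (InstrMem × CState) CAtom CInput where
  step s α s' := s'.1 = s.1 ∧ CStep TD s.1 φ s.2 α s'.2
  start i := (i.prog, initCState TD i)

/-! ## Symbolic IFC rules -/

/-- Label-valued expressions. -/
inductive LExpr
  | bot
  | labPC
  | lab1
  | lab2
  | lab3
  | join (e₁ e₂ : LExpr)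

/-- Boolean-valued expressions. -/
inductive BExpr
  | tru
  | flows (e₁ e₂ : LExpr)
  | and (b₁ b₂ : BExpr)
  | or (b₁ b₂ : BExpr)

/-- A symbolic rule: whether the instruction is allowed, the label of the next program counter and
the label of the result. -/
structure Rule where
  allow : BExpr
  erpc : LExpr
  er : LExpr

abbrev RuleTable := Opcode → Rule

/-- The rule table of the abstract IFC machine; `LExpr.bot` also stands for "don't care". -/
def rulesAbs : RuleTable
  | .add => ⟨.tru, .labPC, .join .lab1 .lab2⟩
  | .sub => ⟨.tru, .labPC, .join .lab1 .lab2⟩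
  | .output => ⟨.tru, .labPC, .join .lab1 .labPC⟩
  | .push => ⟨.tru, .labPC, .bot⟩
  | .load => ⟨.tru, .labPC, .join .lab1 .lab2⟩
  | .store => ⟨.flows (.join .lab1 .labPC) .lab3, .labPC, .join (.join .lab1 .lab2) .labPC⟩
  | .jump => ⟨.tru, .join .lab1 .labPC, .bot⟩
  | .bnz => ⟨.tru, .join .lab1 .labPC, .bot⟩
  | .call => ⟨.tru, .join .lab1 .labPC, .labPC⟩
  | .ret => ⟨.tru, .lab1, .bot⟩

/-! ## Concrete lattices -/

abbrev Code := List Instr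

/-- A concrete lattice: an encoding of labels as integer tags, and code for the lattice
operations. -/
structure ConcreteLattice (L : Type*) where
  Tag : L → ℤ
  Lab : ℤ → L
  lab_tag : ∀ l, Lab (Tag l) = l
  genBot : Code
  genJoin : Code
  genFlows : Code

/-! ## The fault handler generator -/

def genTrue : Code := [.push 1]

def genFalse : Code := [.push 0]

def genPop : Code := [.bnz 1]

def genLoadFrom (p : ℤ) : Code := [.push p, .load]

def genStoreAt (p : ℤ) : Code := [.push p, .store]

def genSkipIf (n : ℕ) : Code := [.bnz (n + 1)]

def genSkip (n : ℕ) : Code := genTrue ++ genSkipIf n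

/-- Test (and pop) the top of the stack; run `t` if it is non-zero and `f` otherwise. -/
def genIf (t f : Code) : Code :=
  let f' := f ++ genSkip t.length
  genSkipIf f'.length ++ f' ++ t

def genNot : Code := genIf genFalse genTrue

def genAnd : Code := genIf [] (genPop ++ genFalse)

def genOr : Code := genIf (genPop ++ genTrue) []

def genEqual : Code := [.sub] ++ genNot

def genSome (c : Code) : Code := c ++ genTrue

def genNone : Code := genFalse

def genIndexedCases {α : Type*} (genDefault : Code) (genGuard genBody : α → Code) :
    List α → Code
  | [] => genDefault
  | n :: ns => genGuard n ++ genIf (genBody n) (genIndexedCases genDefault genGuard genBody ns)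

def genMatchOp (op : Opcode) : Code := [.push op.code] ++ genLoadFrom addrOp ++ genEqual

section Generator

variable {L : Type*} (CL : ConcreteLattice L)

def genELab : LExpr → Code
  | .bot => CL.genBot
  | .labPC => genLoadFrom addrTagPC
  | .lab1 => genLoadFrom addrTag1
  | .lab2 => genLoadFrom addrTag2
  | .lab3 => genLoadFrom addrTag3
  | .join e₁ e₂ => genELab e₂ ++ genELab e₁ ++ CL.genJoin

def genBool : BExpr → Code
  | .tru => genTrue
  | .flows e₁ e₂ => genELab CL e₂ ++ genELab CL e₁ ++ CL.genFlows
  | .and b₁ b₂ => genBool b₂ ++ genBool b₁ ++ genAnd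
  | .or b₁ b₂ => genBool b₂ ++ genBool b₁ ++ genOr

def genApplyRule (r : Rule) : Code :=
  genBool CL r.allow ++ genIf (genSome (genELab CL r.erpc ++ genELab CL r.er)) genNone

def genComputeResults (R : RuleTable) : Code :=
  genIndexedCases [] genMatchOp (fun op => genApplyRule CL (R op)) opcodes

def genStoreResults : Code :=
  genIf (genStoreAt addrTagR ++ genStoreAt addrTagRPC ++ genTrue) genFalse

def genFaultHandler (R : RuleTable) : Code :=
  genComputeResults CL R ++ genStoreResults ++ genIf [.ret] [.push (-1), .jump]

end Generator

/-- The instruction memory that holds `code` from address `0` on, and nothing else. -/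
def loadCode (code : Code) : InstrMem := fun n => code[n]?

/-! ## Correctness of a concrete lattice -/

/-- Zero or more steps of the concrete machine, such that all states but possibly the last are in
kernel mode. -/
def KernelSteps (TD : ℤ) (ι φ : InstrMem) : CState → CState → Prop :=
  Relation.ReflTransGen fun s s' => s.priv = .kernel ∧ CStep TD ι φ s none s'

/-- The list `code` is stored in `φ` from address `n` on. -/
def CodeAt (φ : InstrMem) (n : ℕ) (code : Code) : Prop :=
  ∀ i (h : i < code.length), φ (n + i) = some code[i]

/-- The (total correctness) Hoare triple for self-contained code: wherever `c` is stored in the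
kernel instruction memory, from any kernel memory and stack satisfying `P` the machine runs in
kernel mode to the address just after `c`, with kernel memory and stack satisfying `Q`. -/
def Triple (TD : ℤ) (P : Mem → Stack → Prop) (c : Code) (Q : Mem → Stack → Prop) : Prop :=
  ∀ (ι φ : InstrMem) (n : ℕ) (κ μ : Mem) (σ : Stack), CodeAt φ n c → P κ σ →
    ∃ κ' σ', Q κ' σ' ∧
      KernelSteps TD ι φ ⟨.kernel, κ, μ, σ, ⟨n, TD⟩⟩
        ⟨.kernel, κ', μ, σ', ⟨(n + c.length : ℕ), TD⟩⟩

open StackElt in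
/-- The concrete lattice is a correct encoding of the lattice `L`: its code meets the
specifications, in weakest-precondition style, of the lattice operations. As a boolean, `0` is
false and every other integer is true. -/
structure ConcreteLattice.Correct {L : Type*} [SemilatticeSup L] [OrderBot L]
    (CL : ConcreteLattice L) (TD : ℤ) : Prop where
  bot : ∀ Q : Mem → Stack → Prop,
    Triple TD (fun κ σ => Q κ (data ⟨CL.Tag ⊥, TD⟩ :: σ)) CL.genBot Q
  join : ∀ Q : Mem → Stack → Prop,
    Triple TD (fun κ σ => ∃ (l₁ l₂ : L) (σ' : Stack),
        σ = data ⟨CL.Tag l₁, TD⟩ :: data ⟨CL.Tag l₂, TD⟩ :: σ' ∧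
          Q κ (data ⟨CL.Tag (l₁ ⊔ l₂), TD⟩ :: σ')) CL.genJoin Q
  flows : ∀ Q : Mem → Stack → Prop,
    Triple TD (fun κ σ => ∃ (l₁ l₂ : L) (σ' : Stack),
        σ = data ⟨CL.Tag l₁, TD⟩ :: data ⟨CL.Tag l₂, TD⟩ :: σ' ∧
          ∀ b : ℤ, (b ≠ 0 ↔ l₁ ≤ l₂) → Q κ (data ⟨b, TD⟩ :: σ')) CL.genFlows Q

/-! ## Observation of the concrete machine -/

/-- Two labelled atoms are indistinguishable to `o` if they are equal or neither is observable. -/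
def AtomIndist {L : Type*} [LE L] (o : L) (a₁ a₂ : Atom L) : Prop :=
  a₁ = a₂ ∨ (¬ a₁.tag ≤ o ∧ ¬ a₂.tag ≤ o)

/-- Encode the label of an atom as a tag. -/
def ConcreteLattice.encode {L : Type*} (CL : ConcreteLattice L) (a : Atom L) : CAtom :=
  ⟨a.val, CL.Tag a.tag⟩

/-- Indistinguishability of input data: same program, same memory size, same encoded initial
label, and initial stacks that encode pairwise indistinguishable labelled atoms. -/
inductive InputIndist {L : Type*} [LE L] (CL : ConcreteLattice L) (o : L) :
    CInput → CInput → Prop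
  | mk (p : InstrMem) (args₁ args₂ : List (Atom L)) (n : ℕ) (l : L) :
      List.Forall₂ (AtomIndist o) args₁ args₂ →
      InputIndist CL o ⟨p, args₁.map CL.encode, n, CL.Tag l⟩ ⟨p, args₂.map CL.encode, n, CL.Tag l⟩

/-- The notion of observation for the concrete machine; the observers are the labels. -/
def concreteObservation {L : Type*} [LE L] (CL : ConcreteLattice L) :
    Observation CAtom CInput L where
  observable o e := CL.Lab e.tag ≤ o
  indist := InputIndist CL

end IFC

/-!
Replacing tags by labels and the cache by the rule table gives an abstract machine, for which
noninterference is an unwinding argument. What an observer sees of a state is its memory, program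
counter and stack with the invisible atoms erased; while the program counter is invisible, all of
the stack above the topmost visible return frame counts as invisible too. At a visible program
counter two runs with the same view move in lockstep. At an invisible one every step leaves the
view unchanged and emits nothing visible, except a return to a visible frame, and this frame is
the same in both runs.

The concrete machine refines the abstract one, because a cache whose input part matches an
instruction always holds the output prescribed by the rule table: after a miss the fault handler
either installs it or stops the machine. Hence every concrete trace encodes an abstract one. Since
`Lab` decodes `Tag`, an encoded event is visible exactly when the abstract event is, so that
noninterference carries over.
-/

namespace IFC

/-! ## Unwinding and refinement -/

section Machines

variable {S S' E E' I I' Ω : Type*} {M : Machine S E I} {M' : Machine S' E' I'}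
  {O : Observation E I Ω} {O' : Observation E' I' Ω}

theorem Machine.produces_nil (M : Machine S E I) (s : S) : M.Produces s [] :=
  ⟨s, .refl s⟩

theorem Machine.Produces.of_step {s s' : S} {α : Option E} {t : List E} (h : M.step s α s')
    (ht : M.Produces s' t) : M.Produces s (α.toList ++ t) := by
  obtain ⟨s'', hs⟩ := ht
  cases α with
  | none => exact ⟨s'', .silent h hs⟩
  | some e => exact ⟨s'', .event h hs⟩

@[elab_as_elim]
theorem Machine.Produces.step_induction {motive : ∀ s t, M.Produces s t → Prop}
    (nil : ∀ s, motive s [] (M.produces_nil s))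
    (step : ∀ s α s' t (h : M.step s α s') (ht : M.Produces s' t), motive s' t ht →
      motive s (α.toList ++ t) (ht.of_step h))
    {s : S} {t : List E} (h : M.Produces s t) : motive s t h := by
  obtain ⟨s', h⟩ := h
  induction h with
  | refl s => exact nil s
  | event h ht ih => exact step _ (some _) _ _ h ⟨_, ht⟩ ih
  | silent h ht ih => exact step _ none _ _ h ⟨_, ht⟩ ih

theorem TraceIndist.append_left (t : List E) {t₁ t₂ : List E} (h : TraceIndist t₁ t₂) :
    TraceIndist (t ++ t₁) (t ++ t₂) := by
  induction t with
  | nil => exact h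
  | cons e t ih => exact .cons e ih

theorem TraceIndist.map (f : E → E') {t₁ t₂ : List E} (h : TraceIndist t₁ t₂) :
    TraceIndist (t₁.map f) (t₂.map f) := by
  induction h with
  | nil_left t => exact .nil_left _
  | nil_right t => exact .nil_right _
  | cons e _ ih => exact .cons (f e) ih

theorem Observation.filterTrace_append (O : Observation E I Ω) (o : Ω) (t₁ t₂ : List E) :
    O.filterTrace o (t₁ ++ t₂) = O.filterTrace o t₁ ++ O.filterTrace o t₂ :=
  List.filter_append ..

theorem Observation.filterTrace_map {f : E → E'} {o : Ω}
    (hf : ∀ e, O'.observable o (f e) ↔ O.observable o e) (t : List E) :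
    O'.filterTrace o (t.map f) = (O.filterTrace o t).map f := by
  simp only [Observation.filterTrace, List.filter_map]
  congr 1
  exact List.filter_congr fun e _ => by simp [hf]

theorem Machine.traceIndist_of_unwinding {o : Ω} (rel : S → S → Prop)
    (unwind : ∀ {s₁ s₂ α₁ α₂ s₁' s₂'}, rel s₁ s₂ → M.step s₁ α₁ s₁' → M.step s₂ α₂ s₂' →
      (rel s₁' s₂' ∧ O.filterTrace o α₁.toList = O.filterTrace o α₂.toList) ∨
      (rel s₁' s₂ ∧ O.filterTrace o α₁.toList = []) ∨
      (rel s₁ s₂' ∧ O.filterTrace o α₂.toList = []))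
    {s₁ s₂ : S} {t₁ t₂ : List E} (h : rel s₁ s₂) (h₁ : M.Produces s₁ t₁)
    (h₂ : M.Produces s₂ t₂) : TraceIndist (O.filterTrace o t₁) (O.filterTrace o t₂) := by
  induction h₁ using Machine.Produces.step_induction generalizing s₂ t₂ with
  | nil s₁ => exact .nil_left _
  | step s₁ α₁ s₁' t₁ hstep₁ _ ih₁ =>
    induction h₂ using Machine.Produces.step_induction with
    | nil s₂ => exact .nil_right _
    | step s₂ α₂ s₂' t₂ hstep₂ h₂ ih₂ =>
      obtain ⟨h', hα⟩ | ⟨h', hα⟩ | ⟨h', hα⟩ := unwind h hstep₁ hstep₂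
      · simpa only [Observation.filterTrace_append, hα] using (ih₁ h' h₂).append_left _
      · simpa only [Observation.filterTrace_append, hα, List.nil_append] using
          ih₁ h' (h₂.of_step hstep₂)
      · simpa only [Observation.filterTrace_append, hα, List.nil_append] using ih₂ h'

theorem Machine.Produces.simulate (f : E → E') (rel : S' → S → Prop)
    (sim : ∀ {s' s α s''}, rel s' s → M'.step s' α s'' →
      (α = none ∧ rel s'' s) ∨ ∃ β u, M.step s β u ∧ α = β.map f ∧ rel s'' u)
    {s' : S'} {s : S} {t' : List E'} (h : M'.Produces s' t') (hrel : rel s' s) :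
    ∃ t, M.Produces s t ∧ t' = t.map f := by
  induction h using Machine.Produces.step_induction generalizing s with
  | nil s' => exact ⟨[], M.produces_nil s, rfl⟩
  | step s' α s'' t' hstep _ ih =>
    obtain ⟨rfl, hrel'⟩ | ⟨β, u, hβ, rfl, hrel'⟩ := sim hrel hstep
    · exact ih hrel'
    · obtain ⟨t, ht, rfl⟩ := ih hrel'
      exact ⟨_, ht.of_step hβ, by cases β <;> rfl⟩

theorem Machine.TINI.of_refinement (h : M.TINI O) (event : E → E') (input : I → I')
    (observable_event : ∀ o e, O'.observable o (event e) ↔ O.observable o e)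
    (exists_indist : ∀ o i₁' i₂', O'.indist o i₁' i₂' →
      ∃ i₁ i₂, O.indist o i₁ i₂ ∧ i₁' = input i₁ ∧ i₂' = input i₂)
    (refines : ∀ i t', M'.Produces (M'.start (input i)) t' →
      ∃ t, M.Produces (M.start i) t ∧ t' = t.map event) : M'.TINI O' := by
  intro o i₁' i₂' t₁' t₂' hi h₁ h₂
  obtain ⟨i₁, i₂, hind, rfl, rfl⟩ := exists_indist o _ _ hi
  obtain ⟨t₁, ht₁, rfl⟩ := refines i₁ _ h₁
  obtain ⟨t₂, ht₂, rfl⟩ := refines i₂ _ h₂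
  simpa only [Observation.filterTrace_map (observable_event o)] using
    (h o i₁ i₂ t₁ t₂ hind ht₁ ht₂).map event

end Machines

/-! ## The abstract machine -/

/-- A stack cell of the abstract machine: a datum or a return frame. Frames carry no privilege bit,
since all abstract code runs in user mode. -/
inductive StackCell (α : Type*)
  | data (a : α)
  | frame (pc : α)

/-- Apply a function to the atom in a stack cell. -/
def StackCell.map {α β : Type*} (f : α → β) : StackCell α → StackCell β
  | data a => data (f a)
  | frame pc => frame (f pc)

/-- A state of the abstract machine, which attaches labels in `L`, not integer tags, to values. -/
structure AbstractState (L : Type*) where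
  mem : ℤ → Option (Atom L)
  stack : List (StackCell (Atom L))
  pc : Atom L

/-- The opcode of an instruction, which forgets its immediate operand. -/
def Instr.opcode : Instr → Opcode
  | .add => .add
  | .sub => .sub
  | .output => .output
  | .push _ => .push
  | .load => .load
  | .store => .store
  | .jump => .jump
  | .bnz _ => .bnz
  | .call => .call
  | .ret => .ret

/-- The number of operand labels that an instruction presents to its rule. -/
def Opcode.arity : Opcode → ℕ
  | .push => 0
  | .output | .jump | .bnz | .call | .ret => 1
  | .add | .sub | .load => 2
  | .store => 3

open StackCell in
/-- `Exec rpc r c u ls α u'`: in the state `u` the instruction `c` has operand labels `ls`, and if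
`rpc` and `r` label the next program counter and the result, it leads to `u'` with action `α`. -/
inductive Exec {L : Type*} (rpc r : L) :
    Instr → AbstractState L → List L → Option (Atom L) → AbstractState L → Prop
  | add {μ σ pc a b} :
      Exec rpc r .add ⟨μ, data a :: data b :: σ, pc⟩ [a.tag, b.tag] none
        ⟨μ, data ⟨a.val + b.val, r⟩ :: σ, ⟨pc.val + 1, rpc⟩⟩
  | sub {μ σ pc a b} :
      Exec rpc r .sub ⟨μ, data a :: data b :: σ, pc⟩ [a.tag, b.tag] none
        ⟨μ, data ⟨a.val - b.val, r⟩ :: σ, ⟨pc.val + 1, rpc⟩⟩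
  | output {μ σ pc a} :
      Exec rpc r .output ⟨μ, data a :: σ, pc⟩ [a.tag] (some ⟨a.val, r⟩)
        ⟨μ, σ, ⟨pc.val + 1, rpc⟩⟩
  | push {μ σ pc m} :
      Exec rpc r (.push m) ⟨μ, σ, pc⟩ [] none ⟨μ, data ⟨m, r⟩ :: σ, ⟨pc.val + 1, rpc⟩⟩
  | load {μ : ℤ → Option (Atom L)} {σ pc a b} (ha : μ a.val = some b) :
      Exec rpc r .load ⟨μ, data a :: σ, pc⟩ [a.tag, b.tag] none
        ⟨μ, data ⟨b.val, r⟩ :: σ, ⟨pc.val + 1, rpc⟩⟩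
  | store {μ : ℤ → Option (Atom L)} {σ pc a b old} (ha : μ a.val = some old) :
      Exec rpc r .store ⟨μ, data a :: data b :: σ, pc⟩ [a.tag, b.tag, old.tag] none
        ⟨Function.update μ a.val (some ⟨b.val, r⟩), σ, ⟨pc.val + 1, rpc⟩⟩
  | jump {μ σ pc a} :
      Exec rpc r .jump ⟨μ, data a :: σ, pc⟩ [a.tag] none ⟨μ, σ, ⟨a.val, rpc⟩⟩
  | bnz {μ σ pc a k} :
      Exec rpc r (.bnz k) ⟨μ, data a :: σ, pc⟩ [a.tag] none
        ⟨μ, σ, ⟨pc.val + (if a.val = 0 then 1 else k), rpc⟩⟩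
  | call {μ σ pc a b} :
      Exec rpc r .call ⟨μ, data a :: data b :: σ, pc⟩ [a.tag] none
        ⟨μ, data b :: frame ⟨pc.val + 1, r⟩ :: σ, ⟨a.val, rpc⟩⟩
  | ret {μ σ pc a} :
      Exec rpc r .ret ⟨μ, frame a :: σ, pc⟩ [a.tag] none ⟨μ, σ, ⟨a.val, rpc⟩⟩

/-- The input data of the abstract machine: those of the concrete one, with labels as tags. -/
structure AbstractInput (L : Type*) where
  prog : InstrMem
  args : List (Atom L)
  size : ℕ
  label : L

/-- The initial state, as `initCState` for the concrete machine. -/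
def AbstractInput.initState {L : Type*} (i : AbstractInput L) : AbstractState L where
  mem p := if 0 ≤ p ∧ p < i.size then some ⟨0, i.label⟩ else none
  stack := i.args.map .data
  pc := ⟨0, i.label⟩

section Rules

variable {L : Type*} [SemilatticeSup L] [OrderBot L]

/-- The value of a label expression at the label `lpc` of the program counter and the operand labels
`ls`. A missing operand label counts as `⊥`; the rule tables of interest do not refer to one. -/
def LExpr.eval (lpc : L) (ls : List L) : LExpr → L
  | .bot => ⊥
  | .labPC => lpc
  | .lab1 => ls.getD 0 ⊥
  | .lab2 => ls.getD 1 ⊥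
  | .lab3 => ls.getD 2 ⊥
  | .join e₁ e₂ => e₁.eval lpc ls ⊔ e₂.eval lpc ls

/-- The truth of a boolean expression at the same labels as in `LExpr.eval`. -/
def BExpr.Holds (lpc : L) (ls : List L) : BExpr → Prop
  | .tru => True
  | .flows e₁ e₂ => e₁.eval lpc ls ≤ e₂.eval lpc ls
  | .and b₁ b₂ => b₁.Holds lpc ls ∧ b₂.Holds lpc ls
  | .or b₁ b₂ => b₁.Holds lpc ls ∨ b₂.Holds lpc ls

/-- The instruction `c` leads from `u` to `u'` with action `α`, as the rule table `R` allows. -/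
def InstrStep (R : RuleTable) (c : Instr) (u : AbstractState L) (α : Option (Atom L))
    (u' : AbstractState L) : Prop :=
  ∃ ls, (R c.opcode).allow.Holds u.pc.tag ls ∧
    Exec ((R c.opcode).erpc.eval u.pc.tag ls) ((R c.opcode).er.eval u.pc.tag ls) c u ls α u'

/-- The step relation of the abstract machine with rule table `R` and program `ι`. -/
def AbstractStep (R : RuleTable) (ι : InstrMem) (u : AbstractState L) (α : Option (Atom L))
    (u' : AbstractState L) : Prop :=
  ∃ c, fetch ι u.pc.val = some c ∧ InstrStep R c u α u'

/-- The abstract machine with rule table `R`; as in `concreteMachine`, states carry the program. -/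
def abstractMachine (L : Type*) [SemilatticeSup L] [OrderBot L] (R : RuleTable) :
    Machine (InstrMem × AbstractState L) (Atom L) (AbstractInput L) where
  step s α s' := s'.1 = s.1 ∧ AbstractStep R s.1 s.2 α s'.2
  start i := (i.prog, i.initState)

end Rules

/-! ## Noninterference for the abstract machine -/

section Erasure

variable {L : Type*} [LE L] {o : L}

/-- The notion of observation for the abstract machine: labels observe what flows to them. -/
def abstractObservation (L : Type*) [LE L] : Observation (Atom L) (AbstractInput L) L where
  observable o e := e.tag ≤ o
  indist o i₁ i₂ := i₁.prog = i₂.prog ∧ List.Forall₂ (AtomIndist o) i₁.args i₂.args ∧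
    i₁.size = i₂.size ∧ i₁.label = i₂.label

open Classical in
/-- What `o` sees of an atom: everything if its label flows to `o`, and nothing otherwise. -/
noncomputable def Atom.erase (o : L) (a : Atom L) : Option (Atom L) :=
  if a.tag ≤ o then some a else none

theorem Atom.erase_of_le {a : Atom L} (h : a.tag ≤ o) : a.erase o = some a := if_pos h

theorem Atom.erase_of_not_le {a : Atom L} (h : ¬ a.tag ≤ o) : a.erase o = none := if_neg h

theorem Atom.erase_eq_erase_iff {a b : Atom L} : a.erase o = b.erase o ↔ AtomIndist o a b := by
  by_cases ha : a.tag ≤ o <;> by_cases hb : b.tag ≤ o <;>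
    simp only [erase, AtomIndist, ha, hb, if_true, if_false] <;> grind

theorem filterTrace_singleton_of_not_le {a : Atom L} (h : ¬ a.tag ≤ o) :
    (abstractObservation L).filterTrace o [a] = [] := by
  simp [Observation.filterTrace, abstractObservation, h]

theorem filterTrace_singleton_of_erase_eq {a b : Atom L} (h : a.erase o = b.erase o) :
    (abstractObservation L).filterTrace o [a] = (abstractObservation L).filterTrace o [b] := by
  obtain rfl | ⟨ha, hb⟩ := Atom.erase_eq_erase_iff.1 h
  · rfl
  · rw [filterTrace_singleton_of_not_le ha, filterTrace_singleton_of_not_le hb]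

/-- What `o` sees of a data memory; the domain is always visible. -/
noncomputable def eraseMem (o : L) (μ : ℤ → Option (Atom L)) : ℤ → Option (Option (Atom L)) :=
  Option.map (Atom.erase o) ∘ μ

theorem eraseMem_update (μ : ℤ → Option (Atom L)) (p : ℤ) (a : Atom L) :
    eraseMem o (Function.update μ p (some a)) =
      Function.update (eraseMem o μ) p (some (a.erase o)) :=
  Function.comp_update ..

theorem eraseMem_update_of_not_le {μ : ℤ → Option (Atom L)} {p : ℤ} {a b : Atom L}
    (hp : μ p = some a) (ha : ¬ a.tag ≤ o) (hb : ¬ b.tag ≤ o) :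
    eraseMem o (Function.update μ p (some b)) = eraseMem o μ := by
  have h : eraseMem o μ p = some (b.erase o) := by
    simp [eraseMem, hp, Atom.erase_of_not_le ha, Atom.erase_of_not_le hb]
  rw [eraseMem_update, ← h, Function.update_eq_self]

/-- What `o` sees of the cells of a stack; `AbstractState.view` may hide some of them. -/
noncomputable def eraseStack (o : L) (σ : List (StackCell (Atom L))) :
    List (StackCell (Option (Atom L))) :=
  σ.map (.map (Atom.erase o))

theorem eraseStack_data_cons_inj {a b : Atom L} {σ τ : List (StackCell (Atom L))} :
    eraseStack o (.data a :: σ) = eraseStack o (.data b :: τ) ↔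
      a.erase o = b.erase o ∧ eraseStack o σ = eraseStack o τ := by
  simp [eraseStack, StackCell.map]

theorem eraseStack_frame_cons_inj {a b : Atom L} {σ τ : List (StackCell (Atom L))} :
    eraseStack o (.frame a :: σ) = eraseStack o (.frame b :: τ) ↔
      a.erase o = b.erase o ∧ eraseStack o σ = eraseStack o τ := by
  simp [eraseStack, StackCell.map]

/-- Whether an erased stack cell is a return frame whose program counter is visible. -/
def StackCell.isVisibleFrame {α : Type*} : StackCell (Option α) → Bool
  | .frame (some _) => true
  | _ => false

/-- What `o` sees of a state. If the program counter is not visible, the cells above the topmost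
visible return frame are hidden altogether: code running at such a program counter can pop and push
them freely. -/
noncomputable def AbstractState.view (o : L) (u : AbstractState L) :
    (ℤ → Option (Option (Atom L))) × Option (Atom L) × List (StackCell (Option (Atom L))) :=
  (eraseMem o u.mem, u.pc.erase o,
    if (u.pc.erase o).isSome then eraseStack o u.stack
    else (eraseStack o u.stack).dropWhile (!·.isVisibleFrame))

theorem AbstractState.view_congr {u v : AbstractState L}
    (hmem : eraseMem o u.mem = eraseMem o v.mem) (hpc : u.pc.erase o = v.pc.erase o)
    (hstack : eraseStack o u.stack = eraseStack o v.stack) : u.view o = v.view o := by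
  simp only [view, hmem, hpc, hstack]

theorem AbstractState.view_data_cons_congr {μ₁ μ₂ : ℤ → Option (Atom L)}
    {σ₁ σ₂ : List (StackCell (Atom L))} {a₁ a₂ pc₁ pc₂ : Atom L}
    (hmem : eraseMem o μ₁ = eraseMem o μ₂) (hpc : pc₁.erase o = pc₂.erase o)
    (ha : a₁.erase o = a₂.erase o) (hstack : eraseStack o σ₁ = eraseStack o σ₂) :
    view o ⟨μ₁, .data a₁ :: σ₁, pc₁⟩ = view o ⟨μ₂, .data a₂ :: σ₂, pc₂⟩ :=
  view_congr hmem hpc (eraseStack_data_cons_inj.2 ⟨ha, hstack⟩)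

theorem AbstractState.view_of_le {u : AbstractState L} (h : u.pc.tag ≤ o) :
    u.view o = (eraseMem o u.mem, some u.pc, eraseStack o u.stack) := by
  simp [view, Atom.erase_of_le h]

theorem AbstractState.view_of_not_le {u : AbstractState L} (h : ¬ u.pc.tag ≤ o) :
    u.view o =
      (eraseMem o u.mem, none, (eraseStack o u.stack).dropWhile (!·.isVisibleFrame)) := by
  simp [view, Atom.erase_of_not_le h]

theorem AbstractState.of_view_eq {u v : AbstractState L} (hu : u.pc.tag ≤ o)
    (h : u.view o = v.view o) :
    u.pc = v.pc ∧ eraseMem o u.mem = eraseMem o v.mem ∧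
      eraseStack o u.stack = eraseStack o v.stack := by
  have hpc : u.pc = v.pc := by
    obtain heq | ⟨hu', -⟩ := Atom.erase_eq_erase_iff.1 (congr_arg (·.2.1) h)
    · exact heq
    · exact absurd hu hu'
  rw [view_of_le hu, view_of_le (hpc ▸ hu)] at h
  exact ⟨hpc, congr_arg (·.1) h, congr_arg (·.2.2) h⟩

theorem AbstractState.view_eq_of_not_le {u v : AbstractState L} (hu : ¬ u.pc.tag ≤ o)
    (hv : ¬ v.pc.tag ≤ o) (hmem : eraseMem o u.mem = eraseMem o v.mem)
    (hstack : (eraseStack o u.stack).dropWhile (!·.isVisibleFrame) =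
      (eraseStack o v.stack).dropWhile (!·.isVisibleFrame)) : u.view o = v.view o := by
  rw [view_of_not_le hu, view_of_not_le hv, hmem, hstack]

theorem AbstractInput.view_initState_eq {i₁ i₂ : AbstractInput L}
    (h : (abstractObservation L).indist o i₁ i₂) :
    i₁.initState.view o = i₂.initState.view o := by
  obtain ⟨p, args₁, n, l⟩ := i₁
  obtain ⟨p, args₂, n, l⟩ := i₂
  obtain ⟨rfl, hargs, rfl, rfl⟩ := h
  have herase : args₁.map (Atom.erase o) = args₂.map (Atom.erase o) := by
    rw [← List.forall₂_eq_eq_eq, List.forall₂_map_left_iff, List.forall₂_map_right_iff]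
    exact hargs.imp fun _ _ => Atom.erase_eq_erase_iff.2
  have hstack (args : List (Atom L)) :
      eraseStack o (args.map .data) = (args.map (Atom.erase o)).map .data := by
    simp [eraseStack, StackCell.map, Function.comp_def]
  exact AbstractState.view_congr rfl rfl (by simp only [initState, hstack, herase])

end Erasure

section Noninterference

variable {L : Type*} [SemilatticeSup L] {o : L}

theorem Atom.erase_sup_congr {a a' b b' : Atom L} (f : ℤ → ℤ → ℤ)
    (ha : a.erase o = a'.erase o) (hb : a = a' → b.erase o = b'.erase o) :
    Atom.erase o ⟨f a.val b.val, a.tag ⊔ b.tag⟩ =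
      Atom.erase o ⟨f a'.val b'.val, a'.tag ⊔ b'.tag⟩ := by
  simp only [erase_eq_erase_iff] at *
  obtain rfl | ⟨ha, ha'⟩ := ha
  · obtain rfl | ⟨hb, hb'⟩ := hb rfl
    · exact .inl rfl
    · exact .inr ⟨mt le_sup_right.trans hb, mt le_sup_right.trans hb'⟩
  · exact .inr ⟨mt le_sup_left.trans ha, mt le_sup_left.trans ha'⟩

theorem eraseMem_store_congr {μ₁ μ₂ : ℤ → Option (Atom L)} {a a' b b' old old' : Atom L}
    (l : L) (hmem : eraseMem o μ₁ = eraseMem o μ₂) (ha : a.erase o = a'.erase o)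
    (hb : b.erase o = b'.erase o) (hold : μ₁ a.val = some old) (hold' : μ₂ a'.val = some old')
    (hallow : a.tag ⊔ l ≤ old.tag) (hallow' : a'.tag ⊔ l ≤ old'.tag) :
    eraseMem o (Function.update μ₁ a.val (some ⟨b.val, a.tag ⊔ b.tag ⊔ l⟩)) =
      eraseMem o (Function.update μ₂ a'.val (some ⟨b'.val, a'.tag ⊔ b'.tag ⊔ l⟩)) := by
  obtain rfl | ⟨ha, ha'⟩ := Atom.erase_eq_erase_iff.1 ha
  · have hval : Atom.erase o ⟨b.val, a.tag ⊔ b.tag ⊔ l⟩ =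
        Atom.erase o ⟨b'.val, a.tag ⊔ b'.tag ⊔ l⟩ := by
      have := Atom.erase_sup_congr (b := ⟨0, a.tag ⊔ l⟩) (fun m _ => m) hb fun _ => rfl
      simpa only [sup_comm, sup_left_comm] using this
    rw [eraseMem_update, eraseMem_update, hmem, hval]
  · have hsup {c c' : L} (hc : ¬ c ≤ o) : ¬ c ⊔ c' ⊔ l ≤ o :=
      mt (le_sup_left.trans le_sup_left).trans hc
    rw [eraseMem_update_of_not_le hold _ (hsup ha), hmem,
      eraseMem_update_of_not_le hold' _ (hsup ha')]
    · exact mt (le_sup_left.trans hallow').trans ha'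
    · exact mt (le_sup_left.trans hallow).trans ha

variable [OrderBot L] {ι : InstrMem} {c : Instr} {u u' u₁ u₂ u₁' u₂' : AbstractState L}
  {α α₁ α₂ : Option (Atom L)}

theorem InstrStep.of_pc_not_le (h : InstrStep rulesAbs c u α u') (hpc : ¬ u.pc.tag ≤ o) :
    (u'.view o = u.view o ∧ (abstractObservation L).filterTrace o α.toList = []) ∨
      (α = none ∧ u'.pc.tag ≤ o ∧ u.view o = (eraseMem o u'.mem, none,
        .frame (some u'.pc) :: eraseStack o u'.stack)) := by
  obtain ⟨ls, hallow, hexec⟩ := h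
  have hsup (l : L) : ¬ l ⊔ u.pc.tag ≤ o := mt le_sup_right.trans hpc
  cases hexec with
  | @ret μ σ pc a =>
    by_cases ha : a.tag ≤ o
    · refine .inr ⟨rfl, ha, ?_⟩
      rw [AbstractState.view_of_not_le hpc]
      simp [eraseStack, StackCell.map, Atom.erase_of_le ha, StackCell.isVisibleFrame, rulesAbs,
        Instr.opcode, LExpr.eval]
    · refine .inl ⟨AbstractState.view_eq_of_not_le ha hpc rfl ?_, rfl⟩
      simp [eraseStack, StackCell.map, Atom.erase_of_not_le ha, StackCell.isVisibleFrame]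
  | @store μ σ pc a b old hold =>
    have hold' : ¬ old.tag ≤ o := mt (le_trans hallow) (hsup a.tag)
    have hmem :=
      eraseMem_update_of_not_le (b := ⟨b.val, a.tag ⊔ b.tag ⊔ pc.tag⟩) hold hold' (hsup _)
    exact .inl ⟨AbstractState.view_eq_of_not_le hpc hpc hmem rfl, rfl⟩
  | output =>
    exact .inl ⟨AbstractState.view_eq_of_not_le hpc hpc rfl rfl,
      filterTrace_singleton_of_not_le (hsup _)⟩
  | add | sub | push | load => exact .inl ⟨AbstractState.view_eq_of_not_le hpc hpc rfl rfl, rfl⟩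
  | jump | bnz => exact .inl ⟨AbstractState.view_eq_of_not_le (hsup _) hpc rfl rfl, rfl⟩
  | @call μ σ pc a b =>
    refine .inl ⟨AbstractState.view_eq_of_not_le (hsup _) hpc rfl ?_, rfl⟩
    have hframe : Atom.erase o ⟨pc.val + 1, pc.tag⟩ = none := Atom.erase_of_not_le hpc
    simp [eraseStack, StackCell.map, StackCell.isVisibleFrame, rulesAbs, Instr.opcode, LExpr.eval,
      hframe]

theorem InstrStep.view_congr (h₁ : InstrStep rulesAbs c u₁ α₁ u₁')
    (h₂ : InstrStep rulesAbs c u₂ α₂ u₂') (hpc : u₁.pc = u₂.pc)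
    (hmem : eraseMem o u₁.mem = eraseMem o u₂.mem)
    (hstack : eraseStack o u₁.stack = eraseStack o u₂.stack) :
    u₁'.view o = u₂'.view o ∧
      (abstractObservation L).filterTrace o α₁.toList =
        (abstractObservation L).filterTrace o α₂.toList := by
  obtain ⟨ls₁, hallow₁, hexec₁⟩ := h₁
  obtain ⟨ls₂, hallow₂, hexec₂⟩ := h₂
  obtain ⟨μ₁, σ₁, pc⟩ := u₁
  obtain ⟨μ₂, σ₂, _⟩ := u₂
  obtain rfl : pc = _ := hpc
  have herase (f : ℤ → ℤ → ℤ) {a a' : Atom L} (ha : a.erase o = a'.erase o) :=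
    Atom.erase_sup_congr (b := pc) f ha fun _ => rfl
  cases hexec₁ <;> cases hexec₂ <;>
    simp only [eraseStack_data_cons_inj, eraseStack_frame_cons_inj] at hstack
  case push.push =>
    exact ⟨AbstractState.view_data_cons_congr hmem rfl rfl hstack, rfl⟩
  all_goals obtain ⟨ha, hstack⟩ := hstack
  case ret.ret => exact ⟨AbstractState.view_congr hmem ha hstack, rfl⟩
  case output.output =>
    exact ⟨AbstractState.view_congr hmem rfl hstack,
      filterTrace_singleton_of_erase_eq (herase (fun m _ => m) ha)⟩
  case jump.jump =>
    exact ⟨AbstractState.view_congr hmem (herase (fun m _ => m) ha) hstack, rfl⟩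
  case bnz.bnz k _ _ =>
    exact ⟨AbstractState.view_congr hmem (herase (fun m n => n + if m = 0 then 1 else k) ha)
      hstack, rfl⟩
  case load.load a b hb _ a' b' hb' =>
    have hbb' : a = a' → b.erase o = b'.erase o := by
      rintro rfl
      simpa [eraseMem, hb, hb'] using congr_fun hmem a.val
    exact ⟨AbstractState.view_data_cons_congr hmem rfl
      (Atom.erase_sup_congr (fun _ n => n) ha hbb') hstack, rfl⟩
  all_goals obtain ⟨hb, hstack⟩ := hstack
  case add.add =>
    exact ⟨AbstractState.view_data_cons_congr hmem rfl
      (Atom.erase_sup_congr (· + ·) ha fun _ => hb) hstack, rfl⟩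
  case sub.sub =>
    exact ⟨AbstractState.view_data_cons_congr hmem rfl
      (Atom.erase_sup_congr (· - ·) ha fun _ => hb) hstack, rfl⟩
  case call.call =>
    exact ⟨AbstractState.view_data_cons_congr hmem (herase (fun m _ => m) ha) hb
      (eraseStack_frame_cons_inj.2 ⟨rfl, hstack⟩), rfl⟩
  case store.store hold _ _ _ _ hold' =>
    exact ⟨AbstractState.view_congr
      (eraseMem_store_congr _ hmem ha hb hold hold' hallow₁ hallow₂) rfl hstack, rfl⟩

theorem AbstractStep.view_congr (h₁ : AbstractStep rulesAbs ι u₁ α₁ u₁')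
    (h₂ : AbstractStep rulesAbs ι u₂ α₂ u₂') (hpc : u₁.pc.tag ≤ o)
    (hview : u₁.view o = u₂.view o) :
    u₁'.view o = u₂'.view o ∧
      (abstractObservation L).filterTrace o α₁.toList =
        (abstractObservation L).filterTrace o α₂.toList := by
  obtain ⟨hpc_eq, hmem, hstack⟩ := AbstractState.of_view_eq hpc hview
  obtain ⟨c₁, hc₁, h₁⟩ := h₁
  obtain ⟨c₂, hc₂, h₂⟩ := h₂
  obtain rfl : c₁ = c₂ := Option.some_injective _ (hc₁.symm.trans (hpc_eq ▸ hc₂))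
  exact h₁.view_congr h₂ hpc_eq hmem hstack

theorem abstractMachine_tini (L : Type*) [SemilatticeSup L] [OrderBot L] :
    (abstractMachine L rulesAbs).TINI (abstractObservation L) := by
  intro o i₁ i₂ t₁ t₂ hi h₁ h₂
  refine Machine.traceIndist_of_unwinding (fun s₁ s₂ => s₁.1 = s₂.1 ∧ s₁.2.view o = s₂.2.view o)
    ?_ ⟨hi.1, AbstractInput.view_initState_eq hi⟩ h₁ h₂
  rintro ⟨ι, u₁⟩ ⟨_, u₂⟩ α₁ α₂ ⟨_, u₁'⟩ ⟨_, u₂'⟩ ⟨rfl, hview⟩ ⟨rfl, hstep₁⟩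
    ⟨rfl, hstep₂⟩
  dsimp only at hview hstep₁ hstep₂ ⊢
  by_cases hpc₁ : u₁.pc.tag ≤ o
  · exact .inl ((hstep₁.view_congr hstep₂ hpc₁ hview).imp_left fun hview' => ⟨rfl, hview'⟩)
  have hpc₂ : ¬ u₂.pc.tag ≤ o := fun hpc₂ =>
    hpc₁ ((AbstractState.of_view_eq hpc₂ hview.symm).1 ▸ hpc₂)
  obtain ⟨_, -, hinstr₁⟩ := hstep₁
  obtain ⟨_, -, hinstr₂⟩ := hstep₂
  obtain ⟨hview₁, hα₁⟩ | ⟨rfl, hpc₁', hview₁⟩ := hinstr₁.of_pc_not_le hpc₁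
  · exact .inr (.inl ⟨⟨rfl, hview₁.trans hview⟩, hα₁⟩)
  obtain ⟨hview₂, hα₂⟩ | ⟨rfl, hpc₂', hview₂⟩ := hinstr₂.of_pc_not_le hpc₂
  · exact .inr (.inr ⟨⟨rfl, hview.trans hview₂.symm⟩, hα₂⟩)
  · refine .inl ⟨⟨rfl, ?_⟩, rfl⟩
    rw [hview₁, hview₂] at hview
    rw [AbstractState.view_of_le hpc₁', AbstractState.view_of_le hpc₂']
    simpa using hview

end Noninterference

/-! ## Hoare rules for kernel code -/

section CodeLayout

variable {φ : InstrMem} {n : ℕ}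

theorem CodeAt.left {c₁ c₂ : Code} (h : CodeAt φ n (c₁ ++ c₂)) : CodeAt φ n c₁ := fun i hi => by
  rw [h i (by rw [List.length_append]; omega), List.getElem_append_left hi]

theorem CodeAt.right {c₁ c₂ : Code} (h : CodeAt φ n (c₁ ++ c₂)) :
    CodeAt φ (n + c₁.length) c₂ := fun i hi => by
  rw [add_assoc, h (c₁.length + i) (by rw [List.length_append]; omega),
    List.getElem_append_right (by omega)]
  simp only [Nat.add_sub_cancel_left]

theorem CodeAt.tail {x : Instr} {c : Code} (h : CodeAt φ n (x :: c)) : CodeAt φ (n + 1) c :=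
  CodeAt.right (c₁ := [x]) h

theorem CodeAt.fetch_head {x : Instr} {c : Code} (h : CodeAt φ n (x :: c)) :
    fetch φ n = some x :=
  h 0 (Nat.succ_pos _)

theorem codeAt_loadCode (c : Code) : CodeAt (loadCode c) 0 c := fun i hi => by
  simp [loadCode, hi]

theorem genIf_eq (t f : Code) :
    genIf t f = .bnz (f.length + 3) :: (f ++ .push 1 :: .bnz (t.length + 1) :: t) := by
  simp [genIf, genSkipIf, genSkip, genTrue, add_assoc]

theorem length_genIf (t f : Code) : (genIf t f).length = f.length + t.length + 3 := by
  simp only [genIf_eq, List.length_cons, List.length_append]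
  omega

theorem CodeAt.genIf_else {t f : Code} (h : CodeAt φ n (genIf t f)) : CodeAt φ (n + 1) f := by
  rw [genIf_eq] at h
  exact h.tail.left

theorem CodeAt.genIf_then {t f : Code} (h : CodeAt φ n (genIf t f)) :
    CodeAt φ (n + (f.length + 3)) t := by
  rw [genIf_eq] at h
  rw [show n + (f.length + 3) = n + 1 + f.length + 1 + 1 by omega]
  exact h.tail.right.tail.tail

end CodeLayout

section KernelRuns

variable {TD : ℤ} {ι φ : InstrMem} {n : ℕ} {κ μ : Mem} {σ : Stack}

theorem kernelSteps_bnz {k : ℤ} {a : CAtom} (hf : fetch φ n = some (.bnz k)) :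
    KernelSteps TD ι φ ⟨.kernel, κ, μ, .data a :: σ, ⟨n, TD⟩⟩
      ⟨.kernel, κ, μ, σ, ⟨n + (if a.val = 0 then 1 else k), TD⟩⟩ :=
  .single ⟨rfl, .bnzK hf⟩

theorem kernelSteps_genIf_then {t f : Code} {a : CAtom} (hc : CodeAt φ n (genIf t f))
    (ha : a.val ≠ 0) :
    KernelSteps TD ι φ ⟨.kernel, κ, μ, .data a :: σ, ⟨n, TD⟩⟩
      ⟨.kernel, κ, μ, σ, ⟨(n + (f.length + 3) : ℕ), TD⟩⟩ := by
  rw [genIf_eq] at hc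
  simpa [ha] using kernelSteps_bnz (a := a) hc.fetch_head

theorem kernelSteps_genIf_else {t f : Code} {a : CAtom} (hc : CodeAt φ n (genIf t f))
    (ha : a.val = 0) :
    KernelSteps TD ι φ ⟨.kernel, κ, μ, .data a :: σ, ⟨n, TD⟩⟩
      ⟨.kernel, κ, μ, σ, ⟨(n + 1 : ℕ), TD⟩⟩ := by
  rw [genIf_eq] at hc
  simpa [ha] using kernelSteps_bnz (a := a) hc.fetch_head

theorem kernelSteps_genIf_skip_then {t f : Code} (hc : CodeAt φ n (genIf t f)) :
    KernelSteps TD ι φ ⟨.kernel, κ, μ, σ, ⟨(n + 1 + f.length : ℕ), TD⟩⟩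
      ⟨.kernel, κ, μ, σ, ⟨(n + (genIf t f).length : ℕ), TD⟩⟩ := by
  have hend : ((n + (genIf t f).length : ℕ) : ℤ) =
      (n + 1 + f.length + 1 : ℕ) + (if (1 : ℤ) = 0 then 1 else (t.length + 1 : ℤ)) := by
    rw [length_genIf, if_neg one_ne_zero]
    push_cast
    ring
  rw [genIf_eq] at hc
  rw [hend]
  exact .head ⟨rfl, .pushK hc.tail.right.fetch_head⟩
    (kernelSteps_bnz hc.tail.right.tail.fetch_head)

end KernelRuns

section HoareRules

open StackElt

variable {TD : ℤ} {P P' P₁ P₂ Q R : Mem → Stack → Prop}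

theorem Triple.strengthen {c : Code} (h : Triple TD P c Q) (hP : ∀ κ σ, P' κ σ → P κ σ) :
    Triple TD P' c Q :=
  fun ι φ n κ μ σ hc hσ => h ι φ n κ μ σ hc (hP κ σ hσ)

theorem triple_false (c : Code) (Q : Mem → Stack → Prop) : Triple TD (fun _ _ => False) c Q :=
  fun _ _ _ _ _ _ _ h => h.elim

theorem Triple.nil (Q : Mem → Stack → Prop) : Triple TD Q [] Q :=
  fun _ _ _ κ _ σ _ hσ => ⟨κ, σ, hσ, .refl⟩

theorem Triple.append {c₁ c₂ : Code} (h₁ : Triple TD P c₁ Q) (h₂ : Triple TD Q c₂ R) :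
    Triple TD P (c₁ ++ c₂) R := by
  intro ι φ n κ μ σ hc hσ
  obtain ⟨κ', σ', hq, hs⟩ := h₁ ι φ n κ μ σ hc.left hσ
  obtain ⟨κ'', σ'', hr, hs'⟩ := h₂ ι φ _ κ' μ σ' hc.right hq
  refine ⟨κ'', σ'', hr, hs.trans ?_⟩
  rwa [List.length_append, ← add_assoc]

theorem triple_singleton {x : Instr}
    (h : ∀ (ι φ : InstrMem) (n : ℤ) (κ μ : Mem) (σ : Stack), fetch φ n = some x → P κ σ →
      ∃ κ' σ', Q κ' σ' ∧ CStep TD ι φ ⟨.kernel, κ, μ, σ, ⟨n, TD⟩⟩ none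
        ⟨.kernel, κ', μ, σ', ⟨n + 1, TD⟩⟩) : Triple TD P [x] Q := by
  intro ι φ n κ μ σ hc hσ
  obtain ⟨κ', σ', hq, hs⟩ := h ι φ n κ μ σ hc.fetch_head hσ
  exact ⟨κ', σ', hq, .single ⟨rfl, by simpa using hs⟩⟩

theorem triple_push (Q : Mem → Stack → Prop) (m : ℤ) :
    Triple TD (fun κ σ => Q κ (data ⟨m, TD⟩ :: σ)) [.push m] Q :=
  triple_singleton fun _ _ _ _ _ _ hf h => ⟨_, _, h, .pushK hf⟩

theorem triple_sub (Q : Mem → Stack → Prop) :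
    Triple TD (fun κ σ => ∃ a b σ', σ = data a :: data b :: σ' ∧
      Q κ (data ⟨a.val - b.val, TD⟩ :: σ')) [.sub] Q :=
  triple_singleton fun _ _ _ _ _ _ hf ⟨_, _, _, hσ, h⟩ => ⟨_, _, h, hσ ▸ .subK hf⟩

theorem triple_load (Q : Mem → Stack → Prop) :
    Triple TD (fun κ σ => ∃ p a σ', σ = data p :: σ' ∧ κ p.val = some a ∧ Q κ (data a :: σ'))
      [.load] Q :=
  triple_singleton fun _ _ _ _ _ _ hf ⟨_, _, _, hσ, ha, h⟩ => ⟨_, _, h, hσ ▸ .loadK hf ha⟩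

theorem triple_store (Q : Mem → Stack → Prop) :
    Triple TD (fun κ σ => ∃ p a σ', σ = data p :: data a :: σ' ∧ Q (κ.write p.val a) σ')
      [.store] Q :=
  triple_singleton fun _ _ _ _ _ _ hf ⟨_, _, _, hσ, h⟩ => ⟨_, _, h, hσ ▸ .storeK hf⟩

theorem triple_genLoadFrom (Q : Mem → Stack → Prop) (p : ℤ) :
    Triple TD (fun κ σ => ∃ a, κ p = some a ∧ Q κ (data a :: σ)) (genLoadFrom p) Q :=
  ((triple_push _ p).append (triple_load Q)).strengthen
    fun _ _ ⟨a, ha, h⟩ => ⟨_, a, _, rfl, ha, h⟩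

theorem triple_genStoreAt (Q : Mem → Stack → Prop) (p : ℤ) :
    Triple TD (fun κ σ => ∃ a σ', σ = data a :: σ' ∧ Q (κ.write p a) σ') (genStoreAt p) Q :=
  ((triple_push _ p).append (triple_store Q)).strengthen
    fun _ _ ⟨a, _, hσ, h⟩ => ⟨_, a, _, congr_arg _ hσ, h⟩

theorem triple_genPop (Q : Mem → Stack → Prop) :
    Triple TD (fun κ σ => ∃ a σ', σ = data a :: σ' ∧ Q κ σ') genPop Q :=
  triple_singleton fun ι φ n κ μ _ hf ⟨a, σ', hσ, h⟩ => ⟨κ, σ', h, by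
    subst hσ
    simpa using CStep.bnzK (TD := TD) (ι := ι) (κ := κ) (μ := μ) (σ := σ') (tpc := TD)
      (m := a.val) (t₁ := a.tag) hf⟩

theorem Triple.genIf {t f : Code} (ht : Triple TD P₁ t Q) (hf : Triple TD P₂ f Q) :
    Triple TD (fun κ σ => ∃ a σ', σ = data a :: σ' ∧ (a.val ≠ 0 → P₁ κ σ') ∧
      (a.val = 0 → P₂ κ σ')) (genIf t f) Q := by
  rintro ι φ n κ μ _ hc ⟨a, σ, rfl, h₁, h₂⟩
  by_cases ha : a.val = 0
  · obtain ⟨κ', σ', hq, hs⟩ := hf ι φ (n + 1) κ μ σ hc.genIf_else (h₂ ha)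
    exact ⟨κ', σ', hq, (kernelSteps_genIf_else hc ha).trans
      (hs.trans (kernelSteps_genIf_skip_then hc))⟩
  · obtain ⟨κ', σ', hq, hs⟩ := ht ι φ _ κ μ σ hc.genIf_then (h₁ ha)
    have hend : n + (IFC.genIf t f).length = n + (f.length + 3) + t.length := by
      rw [length_genIf]
      omega
    exact ⟨κ', σ', hq, (kernelSteps_genIf_then hc ha).trans (hend ▸ hs)⟩

theorem triple_genNot (Q : Mem → Stack → Prop) :
    Triple TD (fun κ σ => ∃ a σ', σ = data a :: σ' ∧
      Q κ (data ⟨if a.val = 0 then 1 else 0, TD⟩ :: σ')) genNot Q :=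
  ((triple_push Q 0).genIf (triple_push Q 1)).strengthen fun _ _ ⟨a, σ', hσ, h⟩ =>
    ⟨a, σ', hσ, fun ha => by rwa [if_neg ha] at h, fun ha => by rwa [if_pos ha] at h⟩

theorem triple_genAnd (Q : Mem → Stack → Prop) :
    Triple TD (fun κ σ => ∃ a b σ', σ = data a :: data ⟨b, TD⟩ :: σ' ∧
      Q κ (data ⟨if a.val = 0 then 0 else b, TD⟩ :: σ')) genAnd Q :=
  ((Triple.nil Q).genIf ((triple_genPop _).append (triple_push Q 0))).strengthen
    fun _ _ ⟨a, _, _, hσ, h⟩ =>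
      ⟨a, _, hσ, fun ha => by rwa [if_neg ha] at h, fun ha => ⟨_, _, rfl, by rwa [if_pos ha] at h⟩⟩

theorem triple_genOr (Q : Mem → Stack → Prop) :
    Triple TD (fun κ σ => ∃ a b σ', σ = data a :: data ⟨b, TD⟩ :: σ' ∧
      Q κ (data ⟨if a.val = 0 then b else 1, TD⟩ :: σ')) genOr Q :=
  (((triple_genPop _).append (triple_push Q 1)).genIf (Triple.nil Q)).strengthen
    fun _ _ ⟨a, _, _, hσ, h⟩ =>
      ⟨a, _, hσ, fun ha => ⟨_, _, rfl, by rwa [if_neg ha] at h⟩, fun ha => by rwa [if_pos ha] at h⟩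

theorem triple_genMatchOp (Q : Mem → Stack → Prop) (op : Opcode) :
    Triple TD (fun κ σ => ∃ a, κ addrOp = some a ∧
      Q κ (data ⟨if a.val = op.code then 1 else 0, TD⟩ :: σ)) (genMatchOp op) Q :=
  (((triple_push _ op.code).append (triple_genLoadFrom _ addrOp)).append
    ((triple_sub _).append (triple_genNot Q))).strengthen fun _ _ ⟨a, ha, h⟩ =>
      ⟨a, ha, _, _, _, rfl, _, _, rfl, by simpa only [sub_eq_zero] using h⟩

theorem Opcode.code_injective : Function.Injective Opcode.code := by
  intro op₁ op₂ h
  cases op₁ <;> cases op₂ <;> first | rfl | cases h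

theorem triple_genIndexedCases {op : Opcode} {d : Code} {body : Opcode → Code}
    (hP : ∀ κ σ, P κ σ → payload κ addrOp = some op.code) (hbody : Triple TD P (body op) Q)
    {ops : List Opcode} (hop : op ∈ ops) :
    Triple TD P (genIndexedCases d genMatchOp body ops) Q := by
  induction ops with
  | nil => cases hop
  | cons op' ops ih =>
    by_cases h : op = op'
    · subst h
      refine ((triple_genMatchOp _ op).append
        (hbody.genIf (triple_false _ Q))).strengthen fun κ σ hσ => ?_
      obtain ⟨a, ha, hcode⟩ := Option.map_eq_some_iff.1 (hP κ σ hσ)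
      exact ⟨a, ha, _, _, rfl, fun _ => hσ, by simp [hcode]⟩
    · refine ((triple_genMatchOp _ op').append ((triple_false _ Q).genIf
        (ih (List.mem_of_ne_of_mem h hop)))).strengthen fun κ σ hσ => ?_
      obtain ⟨a, ha, hcode⟩ := Option.map_eq_some_iff.1 (hP κ σ hσ)
      have hne : a.val ≠ op'.code := hcode ▸ Opcode.code_injective.ne h
      exact ⟨a, ha, _, _, rfl, by simp [hne], fun _ => hσ⟩

end HoareRules

/-! ## Cache lines and the fault handler -/

section WellFormed

/-- The expression mentions only the first `n` operand labels. -/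
def LExpr.UsesOnly (n : ℕ) : LExpr → Prop
  | .bot => True
  | .labPC => True
  | .lab1 => 0 < n
  | .lab2 => 1 < n
  | .lab3 => 2 < n
  | .join e₁ e₂ => e₁.UsesOnly n ∧ e₂.UsesOnly n

/-- The boolean expression mentions only the first `n` operand labels. -/
def BExpr.UsesOnly (n : ℕ) : BExpr → Prop
  | .tru => True
  | .flows e₁ e₂ => e₁.UsesOnly n ∧ e₂.UsesOnly n
  | .and b₁ b₂ => b₁.UsesOnly n ∧ b₂.UsesOnly n
  | .or b₁ b₂ => b₁.UsesOnly n ∧ b₂.UsesOnly n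

/-- Every rule mentions only operand labels that its instruction has, so that its value does not
depend on the default tags that fill up the cache input. -/
def RuleTable.WellFormed (R : RuleTable) : Prop :=
  ∀ op, (R op).allow.UsesOnly op.arity ∧ (R op).erpc.UsesOnly op.arity ∧
    (R op).er.UsesOnly op.arity

theorem rulesAbs_wellFormed : RuleTable.WellFormed rulesAbs := by
  intro op
  cases op <;> simp [rulesAbs, Opcode.arity, LExpr.UsesOnly, BExpr.UsesOnly]

end WellFormed

section CacheLines

variable {L : Type*} {CL : ConcreteLattice L} {TD : ℤ} {κ : Mem}

theorem ConcreteLattice.tag_injective (CL : ConcreteLattice L) : Function.Injective CL.Tag :=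
  Function.LeftInverse.injective CL.lab_tag

/-- The cache input for the opcode `op`, a program counter labelled `lpc` and the operand labels
`ls`, of which there are at most three; missing ones are filled up with `TD`. -/
def ConcreteLattice.cacheIn (CL : ConcreteLattice L) (TD : ℤ) (op : Opcode) (lpc : L)
    (ls : List L) : CacheIn :=
  ⟨op.code, CL.Tag lpc, (ls.map CL.Tag).getD 0 TD, (ls.map CL.Tag).getD 1 TD,
    (ls.map CL.Tag).getD 2 TD⟩

theorem ConcreteLattice.getD_map_tag {ls : List L} {k : ℕ} (h : k < ls.length) (l : L) :
    (ls.map CL.Tag).getD k TD = CL.Tag (ls.getD k l) := by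
  simp [List.getD_eq_getElem?_getD, h]

theorem Opcode.arity_le_three (op : Opcode) : op.arity ≤ 3 := by
  cases op <;> simp [Opcode.arity]

theorem ConcreteLattice.cacheIn_inj {op op' : Opcode} {lpc lpc' : L} {ls ls' : List L}
    (hls : ls.length = op.arity) (hls' : ls'.length = op'.arity)
    (h : CL.cacheIn TD op lpc ls = CL.cacheIn TD op' lpc' ls') :
    op = op' ∧ lpc = lpc' ∧ ls = ls' := by
  simp only [cacheIn, CacheIn.mk.injEq] at h
  obtain ⟨hop, hlpc, h₀, h₁, h₂⟩ := h
  obtain rfl := Opcode.code_injective hop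
  refine ⟨rfl, CL.tag_injective hlpc, CL.tag_injective.list_map ?_⟩
  refine List.ext_getElem (by simp [hls, hls']) fun k hk hk' => ?_
  rw [← List.getD_eq_getElem _ TD hk, ← List.getD_eq_getElem _ TD hk']
  have hk3 : k < 3 := by
    rw [List.length_map, hls] at hk
    exact hk.trans_le op.arity_le_three
  interval_cases k
  exacts [h₀, h₁, h₂]

/-- The cache in `κ` has input part `i`, all of it tagged `TD`. -/
def HasInput (TD : ℤ) (i : CacheIn) (κ : Mem) : Prop :=
  κ addrOp = some ⟨i.op, TD⟩ ∧ κ addrTagPC = some ⟨i.tpc, TD⟩ ∧ κ addrTag1 = some ⟨i.t1, TD⟩ ∧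
    κ addrTag2 = some ⟨i.t2, TD⟩ ∧ κ addrTag3 = some ⟨i.t3, TD⟩

theorem hasInput_setCache (κ : Mem) (i : CacheIn) : HasInput TD i (setCache TD κ i) := by
  simp [HasInput, setCache, Mem.write, addrOp, addrTagPC, addrTag1, addrTag2, addrTag3,
    addrTagRPC, addrTagR]

theorem HasInput.cacheInputIs {i : CacheIn} (h : HasInput TD i κ) : CacheInputIs κ i := by
  obtain ⟨h₀, h₁, h₂, h₃, h₄⟩ := h
  simp [CacheInputIs, payload, h₀, h₁, h₂, h₃, h₄]

theorem CacheInputIs.unique {i j : CacheIn} (hi : CacheInputIs κ i) (hj : CacheInputIs κ j) :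
    i = j := by
  obtain ⟨i₀, i₁, i₂, i₃, i₄⟩ := i
  obtain ⟨j₀, j₁, j₂, j₃, j₄⟩ := j
  grind [CacheInputIs]

/-- The kernel memory `κ` with `trpc` and `tr`, tagged `TD`, in the output part of the cache. -/
def setCacheOutput (TD : ℤ) (κ : Mem) (trpc tr : ℤ) : Mem :=
  (κ.write addrTagR ⟨tr, TD⟩).write addrTagRPC ⟨trpc, TD⟩

theorem HasInput.setCacheOutput {i : CacheIn} (h : HasInput TD i κ) (trpc tr : ℤ) :
    HasInput TD i (setCacheOutput TD κ trpc tr) := by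
  simpa [HasInput, IFC.setCacheOutput, Mem.write, addrOp, addrTagPC, addrTag1, addrTag2, addrTag3,
    addrTagRPC, addrTagR] using h

theorem cacheOutputIs_setCacheOutput (κ : Mem) (trpc tr : ℤ) :
    CacheOutputIs (setCacheOutput TD κ trpc tr) trpc tr := by
  simp [CacheOutputIs, setCacheOutput, payload, Mem.write, addrTagRPC, addrTagR]

end CacheLines

section Handler

open StackElt

variable {L : Type*} [SemilatticeSup L] [OrderBot L] {CL : ConcreteLattice L} {TD : ℤ}
  {op : Opcode} {lpc : L} {ls : List L}

theorem triple_genELab (hCL : CL.Correct TD) {e : LExpr} (he : e.UsesOnly ls.length)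
    (Q : Mem → Stack → Prop) :
    Triple TD (fun κ σ => HasInput TD (CL.cacheIn TD op lpc ls) κ ∧
        Q κ (data ⟨CL.Tag (e.eval lpc ls), TD⟩ :: σ))
      (genELab CL e) Q := by
  induction e generalizing Q with
  | bot => exact (hCL.bot Q).strengthen fun _ _ h => h.2
  | labPC => exact (triple_genLoadFrom Q _).strengthen fun _ _ ⟨hi, hQ⟩ => ⟨_, hi.2.1, hQ⟩
  | lab1 =>
    exact (triple_genLoadFrom Q _).strengthen fun _ _ ⟨hi, hQ⟩ =>
      ⟨_, hi.2.2.1.trans (by rw [LExpr.eval, ← CL.getD_map_tag he]; rfl), hQ⟩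
  | lab2 =>
    exact (triple_genLoadFrom Q _).strengthen fun _ _ ⟨hi, hQ⟩ =>
      ⟨_, hi.2.2.2.1.trans (by rw [LExpr.eval, ← CL.getD_map_tag he]; rfl), hQ⟩
  | lab3 =>
    exact (triple_genLoadFrom Q _).strengthen fun _ _ ⟨hi, hQ⟩ =>
      ⟨_, hi.2.2.2.2.trans (by rw [LExpr.eval, ← CL.getD_map_tag he]; rfl), hQ⟩
  | join e₁ e₂ ih₁ ih₂ =>
    exact (((ih₂ he.2 _).append (ih₁ he.1 _)).append (hCL.join Q)).strengthen
      fun _ _ ⟨hi, hQ⟩ => ⟨hi, hi, _, _, _, rfl, hQ⟩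

theorem triple_genBool (hCL : CL.Correct TD) {b : BExpr} (hb : b.UsesOnly ls.length)
    (Q : Mem → Stack → Prop) :
    Triple TD (fun κ σ => HasInput TD (CL.cacheIn TD op lpc ls) κ ∧
        ∀ v : ℤ, (v ≠ 0 ↔ b.Holds lpc ls) → Q κ (data ⟨v, TD⟩ :: σ))
      (genBool CL b) Q := by
  induction b generalizing Q with
  | tru => exact (triple_push Q 1).strengthen fun _ _ ⟨_, hQ⟩ => hQ 1 (by simp [BExpr.Holds])
  | flows e₁ e₂ =>
    exact (((triple_genELab hCL hb.2 _).append (triple_genELab hCL hb.1 _)).append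
      (hCL.flows Q)).strengthen fun _ _ ⟨hi, hQ⟩ => ⟨hi, hi, _, _, _, rfl, hQ⟩
  | and b₁ b₂ ih₁ ih₂ =>
    refine (((ih₂ hb.2 _).append (ih₁ hb.1 _)).append (triple_genAnd Q)).strengthen
      fun κ σ ⟨hi, hQ⟩ => ⟨hi, fun v₂ h₂ => ⟨hi, fun v₁ h₁ => ⟨_, _, _, rfl, hQ _ ?_⟩⟩⟩
    rw [BExpr.Holds, ← h₁, ← h₂]
    by_cases hv : v₁ = 0 <;> simp [hv]
  | or b₁ b₂ ih₁ ih₂ =>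
    refine (((ih₂ hb.2 _).append (ih₁ hb.1 _)).append (triple_genOr Q)).strengthen
      fun κ σ ⟨hi, hQ⟩ => ⟨hi, fun v₂ h₂ => ⟨hi, fun v₁ h₁ => ⟨_, _, _, rfl, hQ _ ?_⟩⟩⟩
    rw [BExpr.Holds, ← h₁, ← h₂]
    by_cases hv : v₁ = 0 <;> simp [hv]

theorem triple_genApplyRule (hCL : CL.Correct TD) {r : Rule}
    (hallow : r.allow.UsesOnly ls.length) (herpc : r.erpc.UsesOnly ls.length)
    (her : r.er.UsesOnly ls.length) (Q : Mem → Stack → Prop) :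
    Triple TD (fun κ σ => HasInput TD (CL.cacheIn TD op lpc ls) κ ∧
        (r.allow.Holds lpc ls → Q κ (data ⟨1, TD⟩ :: data ⟨CL.Tag (r.er.eval lpc ls), TD⟩ ::
          data ⟨CL.Tag (r.erpc.eval lpc ls), TD⟩ :: σ)) ∧
        (¬ r.allow.Holds lpc ls → Q κ (data ⟨0, TD⟩ :: σ)))
      (genApplyRule CL r) Q :=
  ((triple_genBool hCL hallow _).append (Triple.genIf
    (((triple_genELab hCL herpc _).append (triple_genELab hCL her _)).append
      (triple_push Q 1)) (triple_push Q 0))).strengthen fun _ _ ⟨hi, hholds, hnot⟩ =>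
  ⟨hi, fun _ hv => ⟨_, _, rfl, fun h => ⟨hi, hi, hholds (hv.1 h)⟩,
    fun h => hnot (mt hv.2 (not_not.2 h))⟩⟩

theorem mem_opcodes (op : Opcode) : op ∈ opcodes := by
  cases op <;> simp [opcodes]

theorem triple_genComputeResults (hCL : CL.Correct TD) {R : RuleTable} (hR : R.WellFormed)
    (hls : ls.length = op.arity) (Q : Mem → Stack → Prop) :
    Triple TD (fun κ σ => HasInput TD (CL.cacheIn TD op lpc ls) κ ∧
        ((R op).allow.Holds lpc ls → Q κ (data ⟨1, TD⟩ ::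
          data ⟨CL.Tag ((R op).er.eval lpc ls), TD⟩ ::
          data ⟨CL.Tag ((R op).erpc.eval lpc ls), TD⟩ :: σ)) ∧
        (¬ (R op).allow.Holds lpc ls → Q κ (data ⟨0, TD⟩ :: σ)))
      (genComputeResults CL R) Q := by
  obtain ⟨hallow, herpc, her⟩ := hls ▸ hR op
  exact triple_genIndexedCases (fun _ _ h => h.1.cacheInputIs.1)
    (triple_genApplyRule hCL hallow herpc her Q) (mem_opcodes op)

theorem triple_genStoreResults (Q : Mem → Stack → Prop) :
    Triple TD (fun κ σ => ∃ a σ', σ = data a :: σ' ∧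
        (a.val ≠ 0 → ∃ b c σ'', σ' = data b :: data c :: σ'' ∧
          Q ((κ.write addrTagR b).write addrTagRPC c) (data ⟨1, TD⟩ :: σ'')) ∧
        (a.val = 0 → Q κ (data ⟨0, TD⟩ :: σ')))
      genStoreResults Q := by
  refine (Triple.genIf (((triple_genStoreAt _ addrTagR).append
    (triple_genStoreAt _ addrTagRPC)).append (triple_push Q 1))
    (triple_push Q 0)).strengthen ?_
  rintro κ σ ⟨a, σ', hσ, hstore, hskip⟩
  refine ⟨a, σ', hσ, fun ha => ?_, hskip⟩
  obtain ⟨b, c, σ'', rfl, h⟩ := hstore ha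
  exact ⟨b, _, rfl, c, _, rfl, h⟩

theorem triple_genComputeResults_genStoreResults (hCL : CL.Correct TD) {R : RuleTable}
    (hR : R.WellFormed) (hls : ls.length = op.arity) (Q : Mem → Stack → Prop) :
    Triple TD (fun κ σ => HasInput TD (CL.cacheIn TD op lpc ls) κ ∧
        ((R op).allow.Holds lpc ls → Q (setCacheOutput TD κ (CL.Tag ((R op).erpc.eval lpc ls))
          (CL.Tag ((R op).er.eval lpc ls))) (data ⟨1, TD⟩ :: σ)) ∧
        (¬ (R op).allow.Holds lpc ls → Q κ (data ⟨0, TD⟩ :: σ)))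
      (genComputeResults CL R ++ genStoreResults) Q :=
  ((triple_genComputeResults hCL hR hls _).append (triple_genStoreResults Q)).strengthen
    fun _ _ ⟨hi, hholds, hnot⟩ =>
      ⟨hi, fun h => ⟨_, _, rfl, fun _ => ⟨_, _, _, rfl, hholds h⟩, fun h₀ => by cases h₀⟩,
        fun h => ⟨_, _, rfl, fun h₀ => absurd rfl h₀, fun _ => hnot h⟩⟩

/-- The machine is in the state in which the fault handler halts it: in kernel mode, at an address
that holds no instruction. -/
def CState.Halted (s : CState) : Prop := s.priv = .kernel ∧ s.pc.val = -1

theorem exists_kernelSteps_genFaultHandler (hCL : CL.Correct TD) {R : RuleTable}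
    (hR : R.WellFormed) (hls : ls.length = op.arity) (ι : InstrMem) {κ : Mem}
    (hκ : HasInput TD (CL.cacheIn TD op lpc ls) κ) (μ : Mem) (σ : Stack) (pc : CAtom) :
    ∃ s', KernelSteps TD ι (loadCode (genFaultHandler CL R))
        ⟨.kernel, κ, μ, .frame pc .user :: σ, ⟨0, TD⟩⟩ s' ∧
      (((R op).allow.Holds lpc ls ∧ s' = ⟨.user, setCacheOutput TD κ
        (CL.Tag ((R op).erpc.eval lpc ls)) (CL.Tag ((R op).er.eval lpc ls)), μ, σ, pc⟩) ∨
      s'.Halted) := by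
  have hc : CodeAt (loadCode (genFaultHandler CL R)) 0 (genFaultHandler CL R) := codeAt_loadCode _
  by_cases hallow : (R op).allow.Holds lpc ls
  · obtain ⟨_, _, ⟨rfl, rfl⟩, hs⟩ :=
      triple_genComputeResults_genStoreResults hCL hR hls (fun κ' σ' =>
        κ' = setCacheOutput TD κ (CL.Tag ((R op).erpc.eval lpc ls))
          (CL.Tag ((R op).er.eval lpc ls)) ∧ σ' = data ⟨1, TD⟩ :: frame pc .user :: σ)
        ι _ 0 κ μ (frame pc .user :: σ) hc.left
        ⟨hκ, fun _ => ⟨rfl, rfl⟩, fun h => absurd hallow h⟩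
    exact ⟨_, hs.trans ((kernelSteps_genIf_then hc.right one_ne_zero).trans
      (.single ⟨rfl, .retK hc.right.genIf_then.fetch_head⟩)), .inl ⟨hallow, rfl⟩⟩
  · obtain ⟨_, _, rfl, hs⟩ :=
      triple_genComputeResults_genStoreResults hCL hR hls
        (fun _ σ' => σ' = data ⟨0, TD⟩ :: frame pc .user :: σ)
        ι _ 0 κ μ (frame pc .user :: σ) hc.left ⟨hκ, fun h => absurd h hallow, fun _ => rfl⟩
    exact ⟨_, hs.trans ((kernelSteps_genIf_else hc.right rfl).trans
      (.head ⟨rfl, .pushK hc.right.genIf_else.fetch_head⟩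
        (.single ⟨rfl, .jumpK hc.right.genIf_else.tail.fetch_head⟩))), .inr ⟨rfl, rfl⟩⟩

end Handler

/-! ## The concrete machine refines the abstract one -/

section Encoding

variable {L : Type*} {CL : ConcreteLattice L} {TD : ℤ} {ι φ : InstrMem}

/-- The concrete stack element for an abstract stack cell; return frames lead to user mode. -/
def StackCell.encode (CL : ConcreteLattice L) : StackCell (Atom L) → StackElt
  | data a => .data (CL.encode a)
  | frame pc => .frame (CL.encode pc) .user

/-- The concrete user-mode state for an abstract state, with kernel memory `κ`. -/
def AbstractState.encode (CL : ConcreteLattice L) (κ : Mem) (u : AbstractState L) : CState :=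
  ⟨.user, κ, Option.map CL.encode ∘ u.mem, u.stack.map (StackCell.encode CL), CL.encode u.pc⟩

/-- The concrete input data for abstract input data. -/
def AbstractInput.encode (CL : ConcreteLattice L) (i : AbstractInput L) : CInput :=
  ⟨i.prog, i.args.map CL.encode, i.size, CL.Tag i.label⟩

theorem initCState_encode (i : AbstractInput L) :
    initCState TD (i.encode CL) = i.initState.encode CL (initKMem TD) := by
  have hmem : initMem i.size (CL.Tag i.label) = Option.map CL.encode ∘ i.initState.mem := by
    funext p
    simp only [initMem, AbstractInput.initState, Function.comp_apply]
    split_ifs <;> rfl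
  simp [initCState, AbstractInput.encode, AbstractState.encode, hmem, AbstractInput.initState,
    StackCell.encode, ConcreteLattice.encode]

theorem StackCell.map_encode_eq_data_cons {σ : List (StackCell (Atom L))} {n t : ℤ} {τ : Stack}
    (h : σ.map (StackCell.encode CL) = .data ⟨n, t⟩ :: τ) :
    ∃ a σ', σ = data a :: σ' ∧ n = a.val ∧ t = CL.Tag a.tag ∧
      σ'.map (StackCell.encode CL) = τ := by
  obtain ⟨c, σ', rfl, hc, hσ'⟩ := List.map_eq_cons_iff.1 h
  cases c with
  | data a => cases hc; exact ⟨a, σ', rfl, rfl, rfl, hσ'⟩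
  | frame pc => cases hc

theorem StackCell.map_encode_eq_frame_cons {σ : List (StackCell (Atom L))} {n t : ℤ} {τ : Stack}
    (h : σ.map (StackCell.encode CL) = .frame ⟨n, t⟩ .user :: τ) :
    ∃ a σ', σ = frame a :: σ' ∧ n = a.val ∧ t = CL.Tag a.tag ∧
      σ'.map (StackCell.encode CL) = τ := by
  obtain ⟨c, σ', rfl, hc, hσ'⟩ := List.map_eq_cons_iff.1 h
  cases c with
  | data a => cases hc
  | frame pc => cases hc; exact ⟨pc, σ', rfl, rfl, rfl, hσ'⟩

theorem ConcreteLattice.comp_encode_eq_some {μ : ℤ → Option (Atom L)} {p n t : ℤ}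
    (h : (Option.map CL.encode ∘ μ) p = some ⟨n, t⟩) :
    ∃ a, μ p = some a ∧ n = a.val ∧ t = CL.Tag a.tag := by
  obtain ⟨a, ha, hat⟩ := Option.map_eq_some_iff.1 h
  cases hat
  exact ⟨a, ha, rfl, rfl⟩

theorem InputIndist.exists_encode [LE L] {o : L} {i₁' i₂' : CInput} (h : InputIndist CL o i₁' i₂') :
    ∃ i₁ i₂, (abstractObservation L).indist o i₁ i₂ ∧ i₁' = i₁.encode CL ∧
      i₂' = i₂.encode CL := by
  obtain ⟨p, args₁, args₂, n, l, hargs⟩ := h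
  exact ⟨⟨p, args₁, n, l⟩, ⟨p, args₂, n, l⟩, ⟨rfl, hargs, rfl, rfl⟩, rfl, rfl⟩

theorem concreteObservation_observable_encode [LE L] (o : L) (a : Atom L) :
    (concreteObservation CL).observable o (CL.encode a) ↔
      (abstractObservation L).observable o a := by
  simp only [concreteObservation, abstractObservation, ConcreteLattice.encode, CL.lab_tag]

open StackCell in
theorem CStep.eq_faultState {u : AbstractState L} {κ : Mem} {α : Option CAtom} {s' : CState}
    (h : CStep TD ι φ (u.encode CL κ) α s') (hs' : s'.priv = .kernel) :
    ∃ op ls, ls.length = op.arity ∧ α = none ∧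
      s' = faultState TD κ (u.encode CL κ).mem (u.encode CL κ).stack (u.encode CL κ).pc
        (CL.cacheIn TD op u.pc.tag ls) := by
  obtain ⟨μ, σ, n, l⟩ := u
  simp only [AbstractState.encode, ConcreteLattice.encode] at h ⊢
  generalize hσ : σ.map (StackCell.encode CL) = σ' at h ⊢
  cases h with
  | addMiss | subMiss =>
    obtain ⟨a, σ, rfl, rfl, rfl, hσ'⟩ := map_encode_eq_data_cons hσ
    obtain ⟨b, σ, rfl, rfl, rfl, rfl⟩ := map_encode_eq_data_cons hσ'
    exact ⟨_, [a.tag, b.tag], rfl, rfl, rfl⟩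
  | outputMiss | jumpMiss | bnzMiss | callMiss =>
    obtain ⟨a, σ, rfl, rfl, rfl, -⟩ := map_encode_eq_data_cons hσ
    exact ⟨_, [a.tag], rfl, rfl, rfl⟩
  | pushMiss => exact ⟨_, [], rfl, rfl, rfl⟩
  | loadMiss _ hp =>
    obtain ⟨a, σ, rfl, rfl, rfl, rfl⟩ := map_encode_eq_data_cons hσ
    obtain ⟨b, -, rfl, rfl⟩ := CL.comp_encode_eq_some hp
    exact ⟨_, [a.tag, b.tag], rfl, rfl, rfl⟩
  | storeMiss _ hp =>
    obtain ⟨a, σ, rfl, rfl, rfl, hσ'⟩ := map_encode_eq_data_cons hσ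
    obtain ⟨b, σ, rfl, rfl, rfl, rfl⟩ := map_encode_eq_data_cons hσ'
    obtain ⟨old, -, rfl, rfl⟩ := CL.comp_encode_eq_some hp
    exact ⟨_, [a.tag, b.tag, old.tag], rfl, rfl, rfl⟩
  | retMiss =>
    obtain ⟨a, σ, rfl, rfl, rfl, rfl⟩ := map_encode_eq_frame_cons hσ
    exact ⟨_, [a.tag], rfl, rfl, rfl⟩
  | _ => cases hs'

theorem CStep.kernel_silent {s s' : CState} {α : Option CAtom} (hs : s.priv = .kernel)
    (h : CStep TD ι φ s α s') : α = none := by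
  cases h <;> first | rfl | cases hs

theorem CStep.kernel_deterministic {s s₁ s₂ : CState} {α₁ α₂ : Option CAtom}
    (hs : s.priv = .kernel) (h₁ : CStep TD ι φ s α₁ s₁) (h₂ : CStep TD ι φ s α₂ s₂) :
    s₁ = s₂ := by
  obtain ⟨π, κ, μ, σ, pc⟩ := s
  obtain rfl : π = .kernel := hs
  cases h₁ <;> cases h₂ <;> simp_all

theorem CState.Halted.not_step {s s' : CState} {α : Option CAtom} (hs : s.Halted) :
    ¬ CStep TD ι φ s α s' := by
  obtain ⟨π, κ, μ, σ, n, t⟩ := s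
  obtain ⟨rfl, rfl⟩ : π = .kernel ∧ n = -1 := hs
  intro h
  cases h <;> rename_i hf <;> cases hf

end Encoding

section Steps

open StackCell

variable {L : Type*} [SemilatticeSup L] [OrderBot L] {CL : ConcreteLattice L} {TD : ℤ}
  {R : RuleTable} {κ : Mem} {ι φ : InstrMem} {u : AbstractState L} {α : Option CAtom}
  {s' : CState}

/-- Whatever the cache in `κ` holds for a legal opcode and encoded labels is what the rule table
yields. -/
def CacheValid (CL : ConcreteLattice L) (TD : ℤ) (R : RuleTable) (κ : Mem) : Prop :=
  ∀ ⦃op lpc ls trpc tr⦄, ls.length = op.arity → CacheHit κ (CL.cacheIn TD op lpc ls) trpc tr →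
    (R op).allow.Holds lpc ls ∧ trpc = CL.Tag ((R op).erpc.eval lpc ls) ∧
      tr = CL.Tag ((R op).er.eval lpc ls)

theorem cacheValid_initKMem : CacheValid CL TD R (initKMem TD) := by
  intro op lpc ls trpc tr _ h
  have hop := congr_arg CacheIn.op (h.1.unique (hasInput_setCache _ _).cacheInputIs)
  cases op <;> cases hop

theorem cacheValid_setCacheOutput {op : Opcode} {lpc : L} {ls : List L}
    (hκ : HasInput TD (CL.cacheIn TD op lpc ls) κ) (hls : ls.length = op.arity)
    (hallow : (R op).allow.Holds lpc ls) :
    CacheValid CL TD R (setCacheOutput TD κ (CL.Tag ((R op).erpc.eval lpc ls))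
      (CL.Tag ((R op).er.eval lpc ls))) := by
  intro op' lpc' ls' trpc tr hls' h
  obtain ⟨rfl, rfl, rfl⟩ := ConcreteLattice.cacheIn_inj hls hls'
    ((hκ.setCacheOutput _ _).cacheInputIs.unique h.1)
  obtain ⟨hrpc, hr⟩ := cacheOutputIs_setCacheOutput (TD := TD) κ
    (CL.Tag ((R op).erpc.eval lpc ls)) (CL.Tag ((R op).er.eval lpc ls))
  exact ⟨hallow, Option.some.inj (h.2.1.symm.trans hrpc), Option.some.inj (h.2.2.symm.trans hr)⟩

theorem CStep.abstractStep_of_cacheValid (hκ : CacheValid CL TD R κ)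
    (h : CStep TD ι φ (u.encode CL κ) α s') (hs' : s'.priv = .user) :
    ∃ β u', AbstractStep R ι u β u' ∧ α = β.map CL.encode ∧ s' = u'.encode CL κ := by
  obtain ⟨μ, σ, n, l⟩ := u
  simp only [AbstractState.encode, ConcreteLattice.encode] at h
  generalize hσ : σ.map (StackCell.encode CL) = σ' at h
  cases h with
  | add hf hit | sub hf hit =>
    obtain ⟨a, σ, rfl, rfl, rfl, hσ'⟩ := map_encode_eq_data_cons hσ
    obtain ⟨b, σ, rfl, rfl, rfl, rfl⟩ := map_encode_eq_data_cons hσ'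
    obtain ⟨hallow, rfl, rfl⟩ := hκ (ls := [a.tag, b.tag]) rfl hit
    exact ⟨_, _, ⟨_, hf, _, hallow, by constructor⟩, rfl, rfl⟩
  | output hf hit | jump hf hit | bnz hf hit =>
    obtain ⟨a, σ, rfl, rfl, rfl, rfl⟩ := map_encode_eq_data_cons hσ
    obtain ⟨hallow, rfl, rfl⟩ := hκ (ls := [a.tag]) rfl hit
    exact ⟨_, _, ⟨_, hf, _, hallow, by constructor⟩, rfl, rfl⟩
  | push hf hit =>
    obtain ⟨hallow, rfl, rfl⟩ := hκ (ls := []) rfl hit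
    exact ⟨_, _, ⟨_, hf, _, hallow, .push⟩, rfl, hσ ▸ rfl⟩
  | load hf hp hit =>
    obtain ⟨a, σ, rfl, rfl, rfl, rfl⟩ := map_encode_eq_data_cons hσ
    obtain ⟨b, hb, rfl, rfl⟩ := CL.comp_encode_eq_some hp
    obtain ⟨hallow, rfl, rfl⟩ := hκ (ls := [a.tag, b.tag]) rfl hit
    exact ⟨_, _, ⟨_, hf, _, hallow, .load hb⟩, rfl, rfl⟩
  | store hf hp hit =>
    obtain ⟨a, σ, rfl, rfl, rfl, hσ'⟩ := map_encode_eq_data_cons hσ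
    obtain ⟨b, σ, rfl, rfl, rfl, rfl⟩ := map_encode_eq_data_cons hσ'
    obtain ⟨old, hold, rfl, rfl⟩ := CL.comp_encode_eq_some hp
    obtain ⟨hallow, rfl, rfl⟩ := hκ (ls := [a.tag, b.tag, old.tag]) rfl hit
    exact ⟨_, _, ⟨_, hf, _, hallow, .store hold⟩, rfl,
      by simp only [AbstractState.encode, Function.comp_update]; rfl⟩
  | @call _ _ _ _ _ _ _ c _ _ hf hit =>
    cases c
    obtain ⟨a, σ, rfl, rfl, rfl, hσ'⟩ := map_encode_eq_data_cons hσ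
    obtain ⟨b, σ, rfl, rfl, rfl, rfl⟩ := map_encode_eq_data_cons hσ'
    obtain ⟨hallow, rfl, rfl⟩ := hκ (ls := [a.tag]) rfl hit
    exact ⟨_, _, ⟨_, hf, _, hallow, .call⟩, rfl, rfl⟩
  | ret hf hit =>
    obtain ⟨a, σ, rfl, rfl, rfl, rfl⟩ := map_encode_eq_frame_cons hσ
    obtain ⟨hallow, rfl, rfl⟩ := hκ (ls := [a.tag]) rfl hit
    exact ⟨_, _, ⟨_, hf, _, hallow, .ret⟩, rfl, rfl⟩
  | _ => cases hs'

/-- The concrete state `s` represents the abstract state `u`: kernel code leads from `s` to the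
encoding of `u` with a valid cache, or halts. -/
def Represents (CL : ConcreteLattice L) (TD : ℤ) (R : RuleTable) (ι φ : InstrMem) (s : CState)
    (u : AbstractState L) : Prop :=
  ∃ v, KernelSteps TD ι φ s v ∧ ((∃ κ, CacheValid CL TD R κ ∧ v = u.encode CL κ) ∨ v.Halted)

theorem Represents.step_encode (hCL : CL.Correct TD) (hR : R.WellFormed)
    (hκ : CacheValid CL TD R κ)
    (h : CStep TD ι (loadCode (genFaultHandler CL R)) (u.encode CL κ) α s') :
    (α = none ∧ Represents CL TD R ι (loadCode (genFaultHandler CL R)) s' u) ∨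
      ∃ β u', AbstractStep R ι u β u' ∧ α = β.map CL.encode ∧
        Represents CL TD R ι (loadCode (genFaultHandler CL R)) s' u' := by
  cases hs' : s'.priv with
  | user =>
    obtain ⟨β, u', hstep, rfl, rfl⟩ := h.abstractStep_of_cacheValid hκ hs'
    exact .inr ⟨β, u', hstep, rfl, _, .refl, .inl ⟨κ, hκ, rfl⟩⟩
  | kernel =>
    obtain ⟨op, ls, hls, rfl, rfl⟩ := h.eq_faultState hs'
    have hin := hasInput_setCache (TD := TD) κ (CL.cacheIn TD op u.pc.tag ls)
    obtain ⟨v, hv, ⟨hallow, rfl⟩ | hhalt⟩ :=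
      exists_kernelSteps_genFaultHandler hCL hR hls ι hin (u.encode CL κ).mem
        (u.encode CL κ).stack (u.encode CL κ).pc
    · exact .inl ⟨rfl, _, hv, .inl ⟨_, cacheValid_setCacheOutput hin hls hallow, rfl⟩⟩
    · exact .inl ⟨rfl, _, hv, .inr hhalt⟩

theorem Represents.step (hCL : CL.Correct TD) (hR : R.WellFormed) {s : CState}
    (hs : Represents CL TD R ι (loadCode (genFaultHandler CL R)) s u)
    (h : CStep TD ι (loadCode (genFaultHandler CL R)) s α s') :
    (α = none ∧ Represents CL TD R ι (loadCode (genFaultHandler CL R)) s' u) ∨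
      ∃ β u', AbstractStep R ι u β u' ∧ α = β.map CL.encode ∧
        Represents CL TD R ι (loadCode (genFaultHandler CL R)) s' u' := by
  obtain ⟨v, hv, hend⟩ := hs
  obtain rfl | ⟨w, ⟨hker, hw⟩, hwv⟩ := hv.cases_head
  · obtain ⟨κ, hκ, rfl⟩ | hhalt := hend
    · exact step_encode hCL hR hκ h
    · exact absurd h hhalt.not_step
  · obtain rfl := h.kernel_silent hker
    obtain rfl := h.kernel_deterministic hker hw
    exact .inl ⟨rfl, v, hwv, hend⟩

theorem concreteMachine_refines (hCL : CL.Correct TD) (hR : R.WellFormed) (i : AbstractInput L)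
    {t' : List CAtom}
    (h : (concreteMachine TD (loadCode (genFaultHandler CL R))).Produces
      ((concreteMachine TD (loadCode (genFaultHandler CL R))).start (i.encode CL)) t') :
    ∃ t, (abstractMachine L R).Produces ((abstractMachine L R).start i) t ∧
      t' = t.map CL.encode := by
  refine Machine.Produces.simulate CL.encode (fun p a => p.1 = a.1 ∧
    Represents CL TD R a.1 (loadCode (genFaultHandler CL R)) p.2 a.2) ?_ h
    ⟨rfl, _, .refl, .inl ⟨_, cacheValid_initKMem, initCState_encode i⟩⟩
  rintro ⟨ι, s⟩ ⟨_, u⟩ α ⟨_, s'⟩ ⟨rfl, hs⟩ ⟨rfl, hstep⟩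
  obtain ⟨rfl, hs'⟩ | ⟨β, u', hβ, rfl, hs'⟩ := hs.step hCL hR hstep
  · exact .inl ⟨rfl, rfl, hs'⟩
  · exact .inr ⟨β, (_, u'), ⟨rfl, hβ⟩, rfl, rfl, hs'⟩

end Steps

end IFC

theorem mainTheorem1 {L : Type*} [SemilatticeSup L] [OrderBot L] (TD : ℤ)
    (CL : IFC.ConcreteLattice L) (hCL : CL.Correct TD) :
    (IFC.concreteMachine TD (IFC.loadCode (IFC.genFaultHandler CL IFC.rulesAbs))).TINI
      (IFC.concreteObservation CL) :=
  (IFC.abstractMachine_tini L).of_refinement CL.encode (IFC.AbstractInput.encode CL)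
    IFC.concreteObservation_observable_encode (fun _ _ _ => IFC.InputIndist.exists_encode)
    fun i _ => IFC.concreteMachine_refines hCL IFC.rulesAbs_wellFormed i
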